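/- **Theorem 1.2.** Let $m\ge 1$ be an integer. For $q\in(1,m+1]$ put $I_q=[0,\frac{m}{q-1}]$; a $q$-expansion of $x\in I_q$ is a sequence $(c_i)_{i\ge1}\in\{0,1,\dots,m\}^{\mathbb N}$ with $x=\sum_{i\ge1}c_iq^{-i}$. A sequence $(c_i)$ is called infinite if it has no last nonzero digit, and doubly infinite if both $(c_i)$ and $(m-c_i)$ are infinite. Let - $\mathcal B_2(m)$ be the set of $q\in(1,m+1]$ such that some $x\in I_q$ has exactly two different $q$-expansions; - $\mathcal B_2^{(0)}(m)=\mathcal B_2(m)$, let $\mathcal B_2^{(i+1)}(m)$ be the set of $q\in(1,m+1]$ that are accumulation points of $\mathcal B_2^{(i)}(m)$ $(i\ge0)$, and $\mathcal B_2^{(\infty)}(m)=\bigcap_{i\ge0}\mathcal B_2^{(i)}(m)$; - $\mathcal U$ be the set of $q\in(1,m+1]$ for which $1$ has a unique $q$-expansion, and $\overline{\mathcal U}$ its closure; - $\mathcal V$ be the set of $q\in(1,m+1]$ for which $1$ has at most one doubly infinite $q$-expansion; - $\mathcal G(m)=k+1$ if $m=2k$, and $\mathcal G(m)=\frac{k+1+\sqrt{k^2+6k+5}}{2}$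 if $m=2k+1$. Then: (i) $\mathcal B_2(m)$ is compact; (ii) $\overline{\mathcal U}\subset\mathcal B_2^{(\infty)}(m)$ and $\mathcal V\setminus\{\mathcal G(m)\}\subset\mathcal B_2^{(2)}(m)$; (iii) $\mathcal B_2^{(1)}(m)$ and $\mathcal B_2^{(2)}(m)$ have least elements and $\min\mathcal B_2^{(1)}(m)=\min\mathcal B_2^{(2)}(m)=q_f(m)$, where $q_f(m)$ is the largest real root of $q^3-(k+2)q^2+q-k-1=0$ if $m=2k+1$, and of $q^2-(k+1)q-k=0$ if $m=2k$. -/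

import Mathlib

open Set Filter Topology

namespace TwoExpansions

/-- Digit sequences over the alphabet `{0, 1, ..., m}`; the entry with index `i : ℕ` is the digit
with index `i + 1` in the usual numbering `c₁ c₂ c₃ ...`. -/
abbrev Digits (m : ℕ) : Type := ℕ → Fin (m + 1)

/-- `c` is a `q`-expansion of `x`, that is, `x = ∑_{i ≥ 1} c_i / q ^ i`. -/
def IsExpansion {m : ℕ} (q : ℝ) (c : Digits m) (x : ℝ) : Prop :=
  HasSum (fun i : ℕ => (((c i : Fin (m + 1)) : ℕ) : ℝ) / q ^ (i + 1)) x

/-- The interval `I_q = [0, m / (q - 1)]`. -/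
def expansionInterval (m : ℕ) (q : ℝ) : Set ℝ := Icc 0 ((m : ℝ) / (q - 1))

/-- The reflection `(m - c_i)` of a digit sequence. -/
def reflection {m : ℕ} (c : Digits m) : Digits m := fun i => (c i).rev

/-- A sequence is infinite when it has no last nonzero digit. -/
def IsInfinite {m : ℕ} (c : Digits m) : Prop :=
  ¬ ∃ n : ℕ, c n ≠ 0 ∧ ∀ k : ℕ, n < k → c k = 0

/-- A sequence is doubly infinite when it and its reflection are both infinite. -/
def IsDoublyInfinite {m : ℕ} (c : Digits m) : Prop :=
  IsInfinite c ∧ IsInfinite (reflection c)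

/-- `U_q`: the points of `I_q` with a unique `q`-expansion. -/
def univoquePoints (m : ℕ) (q : ℝ) : Set ℝ :=
  {x | x ∈ expansionInterval m q ∧ ∃! c : Digits m, IsExpansion q c x}

/-- `V_q`: the points of `I_q` with at most one doubly infinite `q`-expansion. -/
def vPoints (m : ℕ) (q : ℝ) : Set ℝ :=
  {x | x ∈ expansionInterval m q ∧
    {c : Digits m | IsExpansion q c x ∧ IsDoublyInfinite c}.Subsingleton}

/-- `U`: the bases `q ∈ (1, m + 1]` with `1 ∈ U_q`. -/
def univoqueBases (m : ℕ) : Set ℝ :=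
  {q | q ∈ Ioc (1 : ℝ) (m + 1) ∧ (1 : ℝ) ∈ univoquePoints m q}

/-- `V`: the bases `q ∈ (1, m + 1]` with `1 ∈ V_q`. -/
def vBases (m : ℕ) : Set ℝ :=
  {q | q ∈ Ioc (1 : ℝ) (m + 1) ∧ (1 : ℝ) ∈ vPoints m q}

/-- `B₂(m)`: the bases `q ∈ (1, m + 1]` for which some `x ∈ I_q` has exactly two
`q`-expansions. -/
def twoBases (m : ℕ) : Set ℝ :=
  {q | q ∈ Ioc (1 : ℝ) (m + 1) ∧
    ∃ x ∈ expansionInterval m q, {c : Digits m | IsExpansion q c x}.encard = 2}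

/-- The iterated derived sets: `B₂⁽⁰⁾(m) = B₂(m)`, and `B₂⁽ⁱ⁺¹⁾(m)` consists of the
accumulation points of `B₂⁽ⁱ⁾(m)` in `(1, m + 1]`. -/
def iterTwoBases (m : ℕ) : ℕ → Set ℝ
  | 0 => twoBases m
  | i + 1 => {q | q ∈ Ioc (1 : ℝ) (m + 1) ∧ AccPt q (𝓟 (iterTwoBases m i))}

/-- `B₂⁽∞⁾(m)`: the intersection of all the sets `B₂⁽ⁱ⁾(m)`. -/
def infTwoBases (m : ℕ) : Set ℝ := ⋂ i : ℕ, iterTwoBases m i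

/-- The generalized golden ratio: `k + 1` if `m = 2 k`, and
`(k + 1 + √(k² + 6 k + 5)) / 2` if `m = 2 k + 1`. -/
noncomputable def goldenRatio (m : ℕ) : ℝ :=
  let k : ℝ := ((m / 2 : ℕ) : ℝ)
  if Even m then k + 1 else (k + 1 + √(k ^ 2 + 6 * k + 5)) / 2

end TwoExpansions

/-!
Digit sequences are encoded as integer-valued sequences `a` with value `val q a` in base `q`;
`mirror m a` is the reflection `(m - a_i)` and `shift n a` a tail. A sequence is the only expansion
of its value exactly if no digit can be raised or lowered (`Uni`): every tail following a digit
smaller than `m` has value less than `1`, and so has every reflected tail following a positive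
digit. These conditions persist when `q` grows. Cutting two expansions behind their first
difference shows that `q ∈ B₂` amounts to `1 + val q c = val q d` for unique expansions `c`, `d`
(`exists_uni_of_mem_twoBases`, `mem_twoBases`). Likewise `q ∈ V` amounts to an expansion of `1`
satisfying the weak form of these conditions (`mem_vBases_of_weakUni`, `exists_bal_of_mem_vBases`).

*Closedness.* Let `q` be a limit of bases in `B₂`. By compactness the sequences `c`, `d` may be
taken to converge, and the limits satisfy the weak conditions. If one of these were an equality, a
tail would be an expansion of `1` satisfying the weak conditions, so `q ∈ V`. Hence `q ∈ B₂` when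
`q ∉ V` (`mem_twoBases_of_accPt`), and it remains to see that `V` without the golden ratio lies in
`B₂`, and that `B₂` does not accumulate at the golden ratio.

*Lower bound.* In base `q_f` the only sequences all of whose tails and reflected tails have value
less than `1` are `k^∞`, respectively `(k (k+1))^∞` and `((k+1) k)^∞` (`alternating_of_tails_lt`).
So below `q_f` unique expansions other than `0^∞` and `m^∞` are isolated. At an accumulation point
`q < q_f` of `B₂` either `c` and `d` are eventually constant, and a power series has accumulating
zeros, or the limit of `c` is `0^∞` (or that of `d` is `m^∞`), and then `1` would have to be a limit
of values of unique expansions in a way that is impossible (`le_of_accPt`).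

*Two-parameter families.* Let `q ∈ V \ U` differ from the golden ratio. The quasi-greedy expansion
`a` of `1` is then periodic, and raising the last digit of the period gives a word `w` of value `1`,
of length `n` say. Hence `1 + val q (0^n e) = val q (w e)` for every `e`. Solving
`1 + val p (0^n e_j) = val p (w e_l)` instead, with `j < l` and `val e_j` increasing, gives bases
`p > q` that accumulate at bases which in turn accumulate at `q` (`mem_iterTwoBases_two`). All of
these are in `B₂` if the `e_j` are chosen suitably: take a prefix of `a` none of whose suffixes is a
reflected prefix of `a`, lower its last digit, repeat the result `j` times, continue with `a`, and
reflect (`mem_twoBases_and_iter_of_lexBal`).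

*The closure of `U`.* The bases in which `1` has a periodic expansion that dominates its tails and
strictly dominates their reflections form a subset of `B₂` without isolated points: repeating a
lowered prefix forever leads to another such expansion (`accPt_periodicBases`). This set is
therefore contained in all `B₂⁽ⁱ⁾`, and `U` is contained in its closure: repeat the smallest period
of a long prefix of the expansion of `1` (`Good.exists_periodic`).
-/

namespace TwoExpansions

variable {m : ℕ} {q q' : ℝ} {a b c : ℕ → ℤ}

/-! ### Values of digit sequences -/

/-- `a` takes values in the alphabet `{0, ..., m}`. Integer-valued sequences are used instead of
`Digits m` so that reflection and carrying are plain integer arithmetic. -/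
def Dig (m : ℕ) (a : ℕ → ℤ) : Prop := ∀ i, 0 ≤ a i ∧ a i ≤ m

/-- The tail of `a` starting at index `n`. -/
def shift (n : ℕ) (a : ℕ → ℤ) : ℕ → ℤ := fun i => a (n + i)

/-- The reflection `(m - a_i)`. -/
def mirror (m : ℕ) (a : ℕ → ℤ) : ℕ → ℤ := fun i => m - a i

/-- The value `∑ a_i / q ^ (i + 1)` of `a` in base `q`. -/
noncomputable def val (q : ℝ) (a : ℕ → ℤ) : ℝ := ∑' i, (a i : ℝ) / q ^ (i + 1)

@[simp] lemma shift_apply (n i : ℕ) (a : ℕ → ℤ) : shift n a i = a (n + i) := rfl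

@[simp] lemma mirror_apply (m i : ℕ) (a : ℕ → ℤ) : mirror m a i = m - a i := rfl

@[simp] lemma shift_zero (a : ℕ → ℤ) : shift 0 a = a := by ext i; simp

lemma shift_shift (n k : ℕ) (a : ℕ → ℤ) : shift n (shift k a) = shift (k + n) a := by
  ext i; simp [add_assoc]

lemma mirror_shift (n : ℕ) (a : ℕ → ℤ) : mirror m (shift n a) = shift n (mirror m a) := rfl

@[simp] lemma mirror_mirror (a : ℕ → ℤ) : mirror m (mirror m a) = a := by ext i; simp

lemma Dig.shift (h : Dig m a) (n : ℕ) : Dig m (shift n a) := fun i => h (n + i)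

lemma Dig.mirror (h : Dig m a) : Dig m (mirror m a) := fun i => by
  have := h i; simp; omega

lemma Dig.nonneg (h : Dig m a) (i : ℕ) : (0 : ℝ) ≤ a i := by exact_mod_cast (h i).1

lemma Dig.le (h : Dig m a) (i : ℕ) : (a i : ℝ) ≤ m := by exact_mod_cast (h i).2

lemma hasSum_const_digit (hq : 1 < q) (x : ℝ) :
    HasSum (fun i : ℕ => x / q ^ (i + 1)) (x / (q - 1)) := by
  have h := (hasSum_geometric_of_lt_one (r := q⁻¹) (by positivity) (inv_lt_one_of_one_lt₀ hq)).mul_left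
    (x / q)
  have hq0 : q ≠ 0 := by positivity
  have hq1 : q - 1 ≠ 0 := by linarith
  have hf : (fun i : ℕ => x / q ^ (i + 1)) = fun i : ℕ => x / q * q⁻¹ ^ i := by
    funext i; rw [pow_succ, inv_pow]; field_simp
  have hs : x / (q - 1) = x / q * (1 - q⁻¹)⁻¹ := by field_simp
  rw [hf, hs]
  exact h

lemma Dig.summable (h : Dig m a) (hq : 1 < q) :
    Summable (fun i : ℕ => (a i : ℝ) / q ^ (i + 1)) := by
  refine Summable.of_nonneg_of_le (fun i => ?_) (fun i => ?_) (hasSum_const_digit hq m).summable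
  · have := h.nonneg i; positivity
  · have := h.le i; gcongr

lemma Dig.hasSum (h : Dig m a) (hq : 1 < q) :
    HasSum (fun i : ℕ => (a i : ℝ) / q ^ (i + 1)) (val q a) := (h.summable hq).hasSum

lemma val_nonneg (h : Dig m a) (hq : 1 < q) : 0 ≤ val q a :=
  tsum_nonneg fun i => by have := h.nonneg i; positivity

lemma val_mirror (h : Dig m a) (hq : 1 < q) :
    val q (mirror m a) = m / (q - 1) - val q a := by
  refine HasSum.unique (h.mirror.hasSum hq) ?_
  have hf : (fun i : ℕ => ((mirror m a i : ℤ) : ℝ) / q ^ (i + 1)) =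
      fun i : ℕ => (m : ℝ) / q ^ (i + 1) - a i / q ^ (i + 1) := by
    funext i; simp; ring
  rw [hf]
  exact (hasSum_const_digit hq m).sub (h.hasSum hq)

lemma val_le (h : Dig m a) (hq : 1 < q) : val q a ≤ m / (q - 1) := by
  have := val_nonneg h.mirror hq
  rw [val_mirror h hq] at this
  linarith

/-- Separating the first `n` digits. -/
lemma val_split (h : Dig m a) (hq : 1 < q) (n : ℕ) :
    val q a = ∑ i ∈ Finset.range n, (a i : ℝ) / q ^ (i + 1) + val q (shift n a) / q ^ n := by
  rw [val, ← (h.summable hq).sum_add_tsum_nat_add n, val, ← tsum_div_const]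
  congr 1
  refine tsum_congr fun i => ?_
  have hq0 : q ≠ 0 := by positivity
  simp only [shift_apply]
  rw [div_div, ← pow_add, add_comm i n]
  congr 2; ring

lemma val_head (h : Dig m a) (hq : 1 < q) : q * val q a = a 0 + val q (shift 1 a) := by
  have hq0 : q ≠ 0 := by positivity
  rw [val_split h hq 1]; simp; field_simp

lemma val_shift (h : Dig m a) (hq : 1 < q) (n : ℕ) :
    q * val q (shift n a) = a n + val q (shift (n + 1) a) := by
  rw [val_head (h.shift n) hq, shift_shift]; simp

lemma val_pos (h : Dig m a) (hq : 1 < q) {i : ℕ} (hi : a i ≠ 0) : 0 < val q a := by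
  have h1 : 0 < a i := lt_of_le_of_ne (h i).1 hi.symm
  have h2 : (0 : ℝ) < a i := by exact_mod_cast h1
  refine (h.summable hq).tsum_pos (fun j => ?_) i (by positivity)
  have := h.nonneg j; positivity

lemma eq_zero_of_val (h : Dig m a) (hq : 1 < q) (h0 : val q a ≤ 0) (i : ℕ) : a i = 0 := by
  by_contra hi
  exact (val_pos h hq hi).not_ge h0

lemma val_anti (h : Dig m a) (hq : 1 < q) (hqq : q ≤ q') : val q' a ≤ val q a := by
  refine (h.summable (hq.trans_le hqq)).tsum_le_tsum (fun i => ?_) (h.summable hq)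
  have := h.nonneg i
  have : 0 < q := by linarith
  gcongr

lemma val_strictAnti (h : Dig m a) (hq : 1 < q) (hqq : q < q') (h0 : 0 < val q a) :
    val q' a < val q a := by
  obtain ⟨i, hi⟩ : ∃ i, a i ≠ 0 := by
    by_contra! hc
    simp [val, hc] at h0
  have h1 : 0 < a i := lt_of_le_of_ne (h i).1 hi.symm
  have h2 : (0 : ℝ) < a i := by exact_mod_cast h1
  have hq0 : 0 < q := by linarith
  refine (h.summable (hq.trans hqq)).tsum_lt_tsum (i := i) (fun j => ?_) ?_ (h.summable hq)
  · have := h.nonneg j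
    show (a j : ℝ) / q' ^ (j + 1) ≤ (a j : ℝ) / q ^ (j + 1)
    gcongr
  · gcongr

lemma val_const (hq : 1 < q) (x : ℤ) : val q (fun _ => x) = x / (q - 1) :=
  (hasSum_const_digit hq x).tsum_eq

@[simp] lemma val_zero : val q (fun _ => 0) = 0 := by simp [val]

/-- Joint continuity of the value in the base and the digits. -/
lemma tendsto_val {ι : Type*} {l : Filter ι} {qs : ι → ℝ} {as : ι → ℕ → ℤ} (hq : 1 < q)
    (hqs : Tendsto qs l (𝓝 q)) (has : ∀ n, Dig m (as n)) (h : Tendsto as l (𝓝 a)) :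
    Tendsto (fun n => val (qs n) (as n)) l (𝓝 (val q a)) := by
  obtain ⟨ρ, hρ1, hρq⟩ := exists_between hq
  refine tendsto_tsum_of_dominated_convergence (bound := fun i => (m : ℝ) / ρ ^ (i + 1))
    (hasSum_const_digit hρ1 m).summable (fun i => ?_) ?_
  · have h1 : Tendsto (fun n => ((as n i : ℤ) : ℝ)) l (𝓝 (a i : ℝ)) :=
      (continuous_of_discreteTopology (f := ((↑) : ℤ → ℝ))).continuousAt.tendsto.comp
        ((tendsto_pi_nhds.1 h) i)
    exact h1.div (hqs.pow _) (by positivity)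
  · filter_upwards [hqs.eventually (lt_mem_nhds hρq)] with n hn i
    have h0 := (has n).nonneg i
    have h1 := (has n).le i
    have : 0 < qs n := by linarith
    rw [Real.norm_of_nonneg (by positivity)]
    gcongr

lemma continuousAt_val (h : Dig m a) (hq : 1 < q) : ContinuousAt (fun p => val p a) q :=
  tendsto_val hq tendsto_id (fun _ => h) tendsto_const_nhds

/-- Every positive number of `I_q` has an expansion without last nonzero digit in which every tail
following a digit smaller than `m` has value at most `1` (the quasi-greedy expansion). -/
lemma exists_quasiGreedy (hq : 1 < q) (hqm : q ≤ m + 1) {x : ℝ} (hx0 : 0 < x)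
    (hx : x ≤ m / (q - 1)) :
    ∃ a, Dig m a ∧ val q a = x ∧ (∀ n, 0 < val q (shift n a)) ∧
      ∀ n, a n < m → val q (shift (n + 1) a) ≤ 1 := by
  have hq1 : 0 < q - 1 := by linarith
  -- the largest digit leaving a positive remainder
  let d : ℝ → ℤ := fun r => min (m : ℤ) (⌈q * r⌉ - 1)
  let r : ℕ → ℝ := fun n => Nat.rec x (fun _ s => q * s - d s) n
  have hr0 : r 0 = x := rfl
  have hrs : ∀ n, r (n + 1) = q * r n - d (r n) := fun n => rfl
  have key : ∀ s, 0 < s → s ≤ m / (q - 1) →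
      0 ≤ d s ∧ d s ≤ m ∧ 0 < q * s - d s ∧ q * s - d s ≤ m / (q - 1) ∧
        (d s < m → q * s - d s ≤ 1) := by
    intro s hs hsm
    have hqs : 0 < q * s := by positivity
    have h1 : (1 : ℤ) ≤ ⌈q * s⌉ := Int.one_le_ceil_iff.2 hqs
    have h2 : ((⌈q * s⌉ - 1 : ℤ) : ℝ) < q * s := by
      have := Int.ceil_lt_add_one (q * s); push_cast; linarith
    have h3 := Int.le_ceil (q * s)
    have h4 : d s ≤ ⌈q * s⌉ - 1 := min_le_right _ _
    have h5 : (d s : ℝ) ≤ ((⌈q * s⌉ - 1 : ℤ) : ℝ) := by exact_mod_cast h4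
    have h6 : d s < m → q * s - d s ≤ 1 := by
      intro hlt
      have h7 : d s = ⌈q * s⌉ - 1 := by
        rcases min_choice (m : ℤ) (⌈q * s⌉ - 1) with h | h
        · have : d s = m := h
          omega
        · exact h
      rw [h7]; push_cast; linarith
    have h8 : d s ≤ m := min_le_left _ _
    refine ⟨le_min (by positivity) (by omega), h8, by linarith, ?_, h6⟩
    rcases h8.lt_or_eq with h | h
    · refine (h6 h).trans ?_
      rw [le_div_iff₀ hq1]; linarith
    · rw [h]; push_cast
      rw [le_div_iff₀ hq1] at hsm ⊢
      nlinarith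
  have hr : ∀ n, 0 < r n ∧ r n ≤ m / (q - 1) := by
    intro n
    induction n with
    | zero => exact ⟨hx0, hx⟩
    | succ n ih =>
      have := key _ ih.1 ih.2
      rw [hrs]
      exact ⟨this.2.2.1, this.2.2.2.1⟩
  have hD : Dig m (fun n => d (r n)) := fun n =>
    ⟨(key _ (hr n).1 (hr n).2).1, (key _ (hr n).1 (hr n).2).2.1⟩
  have hval : ∀ n, val q (shift n fun n => d (r n)) = r n := by
    intro n
    have hsum : ∀ k, ∑ i ∈ Finset.range k, ((d (r (n + i)) : ℤ) : ℝ) / q ^ (i + 1)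
        = r n - r (n + k) / q ^ k := by
      intro k
      induction k with
      | zero => simp
      | succ k ih =>
        rw [Finset.sum_range_succ, ih, ← add_assoc, hrs]
        have : q ≠ 0 := by positivity
        field_simp
        ring
    have h1 : Tendsto (fun k => r n - r (n + k) / q ^ k) atTop (𝓝 (r n - 0)) := by
      refine tendsto_const_nhds.sub ?_
      have h2 : Tendsto (fun k : ℕ => (m / (q - 1)) * (q⁻¹) ^ k) atTop (𝓝 ((m / (q - 1)) * 0)) :=
        (tendsto_pow_atTop_nhds_zero_of_lt_one (by positivity)
          (inv_lt_one_of_one_lt₀ hq)).const_mul _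
      rw [mul_zero] at h2
      refine squeeze_zero (fun k => ?_) (fun k => ?_) h2
      · have := (hr (n + k)).1; positivity
      · rw [inv_pow, ← div_eq_mul_inv]
        have := (hr (n + k)).2
        gcongr
    rw [sub_zero] at h1
    refine HasSum.unique ((hD.shift n).hasSum hq) ?_
    refine ((hD.shift n).summable hq).hasSum_iff_tendsto_nat.2 ?_
    convert h1 using 2 with k
    exact hsum k
  refine ⟨fun n => d (r n), hD, ?_, fun n => ?_, fun n hn => ?_⟩
  · rw [← shift_zero (fun n => d (r n)), hval, hr0]
  · rw [hval]; exact (hr n).1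
  · rw [hval, hrs]; exact (key _ (hr n).1 (hr n).2).2.2.2.2 hn

lemma exists_val_eq (hq : 1 < q) (hqm : q ≤ m + 1) {x : ℝ} (hx0 : 0 ≤ x)
    (hx : x ≤ m / (q - 1)) : ∃ a, Dig m a ∧ val q a = x := by
  rcases hx0.eq_or_lt with rfl | h
  · exact ⟨fun _ => 0, fun _ => ⟨le_rfl, by positivity⟩, val_zero⟩
  · obtain ⟨a, h1, h2, -⟩ := exists_quasiGreedy hq hqm h hx
    exact ⟨a, h1, h2⟩

/-! ### Comparing two sequences at their first difference -/

lemma exists_first_diff (h : a ≠ b) : ∃ k, (∀ i < k, a i = b i) ∧ a k ≠ b k := by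
  classical
  have hex : ∃ k, a k ≠ b k := Function.ne_iff.1 h
  exact ⟨Nat.find hex, fun i hi => not_not.1 (Nat.find_min hex hi), Nat.find_spec hex⟩

lemma val_sub_val (ha : Dig m a) (hb : Dig m b) (hq : 1 < q) {k : ℕ} (h : ∀ i < k, a i = b i) :
    val q a - val q b =
      ((a k - b k : ℝ) + (val q (shift (k + 1) a) - val q (shift (k + 1) b))) / q ^ (k + 1) := by
  have h1 : ∑ i ∈ Finset.range k, (a i : ℝ) / q ^ (i + 1)
      = ∑ i ∈ Finset.range k, (b i : ℝ) / q ^ (i + 1) :=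
    Finset.sum_congr rfl fun i hi => by rw [h i (Finset.mem_range.1 hi)]
  rw [val_split ha hq (k + 1), val_split hb hq (k + 1), Finset.sum_range_succ,
    Finset.sum_range_succ, h1]
  ring

/-- Equal values, rewritten at the first difference. -/
lemma diff_eq_of_val_eq (ha : Dig m a) (hb : Dig m b) (hq : 1 < q) {k : ℕ}
    (h : ∀ i < k, a i = b i) (hv : val q a = val q b) :
    (a k - b k : ℝ) = val q (shift (k + 1) b) - val q (shift (k + 1) a) := by
  have h1 := val_sub_val ha hb hq h
  have hq0 : (0 : ℝ) < q ^ (k + 1) := by positivity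
  rw [hv, sub_self, eq_comm, div_eq_zero_iff] at h1
  rcases h1 with h1 | h1
  · linarith
  · exact absurd h1 hq0.ne'

/-- The word `w_0 ⋯ w_{n-1}` followed by the sequence `e`. -/
def glue (n : ℕ) (w e : ℕ → ℤ) : ℕ → ℤ := fun i => if i < n then w i else e (i - n)

lemma glue_of_lt {n i : ℕ} (w e : ℕ → ℤ) (h : i < n) : glue n w e i = w i := if_pos h

@[simp] lemma glue_add (n i : ℕ) (w e : ℕ → ℤ) : glue n w e (n + i) = e i := by simp [glue]

@[simp] lemma shift_glue (n : ℕ) (w e : ℕ → ℤ) : shift n (glue n w e) = e := by ext i; simp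

lemma Dig.glue {n : ℕ} {w e : ℕ → ℤ} (hw : ∀ i < n, 0 ≤ w i ∧ w i ≤ m) (he : Dig m e) :
    Dig m (glue n w e) := fun i => by
  by_cases h : i < n
  · rw [glue_of_lt _ _ h]; exact hw i h
  · simp only [TwoExpansions.glue, h, if_false]; exact he _

lemma val_glue {n : ℕ} {w e : ℕ → ℤ} (hg : Dig m (glue n w e)) (hq : 1 < q) :
    val q (glue n w e) = ∑ i ∈ Finset.range n, (w i : ℝ) / q ^ (i + 1) + val q e / q ^ n := by
  rw [val_split hg hq n, shift_glue]
  congr 1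
  exact Finset.sum_congr rfl fun i hi => by rw [glue_of_lt _ _ (Finset.mem_range.1 hi)]

lemma glue_eq_self (n : ℕ) (a : ℕ → ℤ) : glue n a (shift n a) = a := by
  ext i
  by_cases h : i < n
  · exact glue_of_lt _ _ h
  · obtain ⟨j, rfl⟩ := Nat.exists_eq_add_of_le (not_lt.1 h)
    simp

/-! ### Unique expansions -/

/-- No digit of `a` can be changed: the tail after a digit smaller than `m` has value less than `1`,
and so has the reflected tail after a positive digit. For `1 < q ≤ m + 1` this says that `a` is the
only expansion of its value. -/
def Uni (m : ℕ) (q : ℝ) (a : ℕ → ℤ) : Prop :=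
  Dig m a ∧ ∀ n, (a n < m → val q (shift (n + 1) a) < 1) ∧
    (0 < a n → val q (mirror m (shift (n + 1) a)) < 1)

/-- The closed form of `Uni`, with weak inequalities. -/
def WeakUni (m : ℕ) (q : ℝ) (a : ℕ → ℤ) : Prop :=
  Dig m a ∧ ∀ n, (a n < m → val q (shift (n + 1) a) ≤ 1) ∧
    (0 < a n → val q (mirror m (shift (n + 1) a)) ≤ 1)

lemma Uni.weakUni (h : Uni m q a) : WeakUni m q a :=
  ⟨h.1, fun n => ⟨fun hn => ((h.2 n).1 hn).le, fun hn => ((h.2 n).2 hn).le⟩⟩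

lemma Uni.mirror (h : Uni m q a) : Uni m q (mirror m a) := by
  refine ⟨h.1.mirror, fun n => ⟨fun hn => ?_, fun hn => ?_⟩⟩
  · exact (h.2 n).2 (by simpa using hn)
  · rw [← mirror_shift, mirror_mirror]
    exact (h.2 n).1 (by simpa using hn)

lemma WeakUni.mirror (h : WeakUni m q a) : WeakUni m q (mirror m a) := by
  refine ⟨h.1.mirror, fun n => ⟨fun hn => ?_, fun hn => ?_⟩⟩
  · exact (h.2 n).2 (by simpa using hn)
  · rw [← mirror_shift, mirror_mirror]
    exact (h.2 n).1 (by simpa using hn)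

lemma WeakUni.shift (h : WeakUni m q a) (k : ℕ) : WeakUni m q (shift k a) := by
  refine ⟨h.1.shift k, fun n => ?_⟩
  rw [shift_shift]
  exact h.2 (k + n)

lemma Uni.mono (h : Uni m q a) (hq : 1 < q) (hqq : q ≤ q') : Uni m q' a :=
  ⟨h.1, fun n => ⟨fun hn => (val_anti (h.1.shift _) hq hqq).trans_lt ((h.2 n).1 hn),
    fun hn => (val_anti (h.1.shift _).mirror hq hqq).trans_lt ((h.2 n).2 hn)⟩⟩

lemma Uni.eq_of_val_eq (h : Uni m q a) (hb : Dig m b) (hq : 1 < q) (hv : val q a = val q b) :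
    b = a := by
  by_contra hne
  obtain ⟨k, hk, hd⟩ := exists_first_diff (Ne.symm hne)
  have h1 := diff_eq_of_val_eq h.1 hb hq hk hv
  rcases hd.lt_or_gt with hlt | hlt
  · have h2 := (h.2 k).1 (hlt.trans_le (hb k).2)
    have h3 : (a k : ℝ) + 1 ≤ b k := by exact_mod_cast hlt
    have h4 := val_nonneg (hb.shift (k + 1)) hq
    linarith
  · have h2 := (h.2 k).2 ((hb k).1.trans_lt hlt)
    rw [val_mirror (h.1.shift _) hq] at h2
    have h3 : (b k : ℝ) + 1 ≤ a k := by exact_mod_cast hlt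
    have h4 := val_le (hb.shift (k + 1)) hq
    linarith

/-- Changing the digit `a_n` to `x` and the later digits to those of `e`. -/
lemma exists_replace (ha : Dig m a) (hq : 1 < q) (hqm : q ≤ m + 1) (n : ℕ) {x : ℤ}
    (hx0 : 0 ≤ x) (hxm : x ≤ m)
    (h0 : (x : ℝ) ≤ a n + val q (shift (n + 1) a))
    (h1 : a n + val q (shift (n + 1) a) ≤ x + m / (q - 1)) :
    ∃ b, Dig m b ∧ val q b = val q a ∧ b n = x := by
  obtain ⟨e, he, hev⟩ := exists_val_eq (m := m) hq hqm
    (x := a n + val q (shift (n + 1) a) - x) (by linarith) (by linarith)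
  have hg : Dig m (glue (n + 1) (fun i => if i < n then a i else x) e) := by
    refine Dig.glue (fun i _ => ?_) he
    split_ifs
    · exact ha i
    · exact ⟨hx0, hxm⟩
  refine ⟨_, hg, ?_, ?_⟩
  · have h2 := val_sub_val hg ha hq (k := n)
      (fun i hi => by rw [glue_of_lt _ _ (by omega)]; simp [hi])
    rw [shift_glue, hev, glue_of_lt _ _ (by omega), if_neg (lt_irrefl n)] at h2
    rw [← sub_eq_zero, h2]
    ring
  · rw [glue_of_lt _ _ (by omega), if_neg (lt_irrefl n)]

lemma one_le_max (hq : 1 < q) (hqm : q ≤ m + 1) : 1 ≤ (m : ℝ) / (q - 1) := by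
  rw [le_div_iff₀ (by linarith)]; linarith

lemma uni_of_unique (ha : Dig m a) (hq : 1 < q) (hqm : q ≤ m + 1)
    (h : ∀ b, Dig m b → val q b = val q a → b = a) : Uni m q a := by
  refine ⟨ha, fun n => ⟨fun hn => ?_, fun hn => ?_⟩⟩
  · by_contra! hc
    have h1 := val_le (ha.shift (n + 1)) hq
    obtain ⟨b, hb, hv, hbn⟩ := exists_replace ha hq hqm n (x := a n + 1)
      (by have := (ha n).1; omega) (by omega) (by push_cast; linarith)
      (by push_cast; linarith)
    rw [h b hb hv] at hbn
    omega
  · by_contra! hc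
    rw [val_mirror (ha.shift _) hq] at hc
    have h1 := val_nonneg (ha.shift (n + 1)) hq
    obtain ⟨b, hb, hv, hbn⟩ := exists_replace ha hq hqm n (x := a n - 1)
      (by omega) (by have := (ha n).2; omega) (by push_cast; linarith)
      (by push_cast; linarith)
    rw [h b hb hv] at hbn
    omega

/-- Once the value of a tail is less than `1`, so are the values of all later tails. -/
lemma tail_lt_of_le (ha : Dig m a) (hq : 1 < q) (hqm : q ≤ m + 1)
    (h : ∀ n, a n < m → val q (shift (n + 1) a) < 1) {p : ℕ} (hp : val q (shift p a) < 1) {n : ℕ}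
    (hn : p ≤ n) : val q (shift n a) < 1 := by
  induction n, hn using Nat.le_induction with
  | base => exact hp
  | succ n _ ih =>
    rcases (ha n).2.lt_or_eq with h1 | h1
    · exact h n h1
    · have h2 := val_shift ha hq n
      have h3 : (a n : ℝ) = m := by exact_mod_cast h1
      nlinarith

lemma tail_le_of_le (ha : Dig m a) (hq : 1 < q) (hqm : q ≤ m + 1)
    (h : ∀ n, a n < m → val q (shift (n + 1) a) ≤ 1) {p : ℕ} (hp : val q (shift p a) ≤ 1) {n : ℕ}
    (hn : p ≤ n) : val q (shift n a) ≤ 1 := by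
  induction n, hn using Nat.le_induction with
  | base => exact hp
  | succ n _ ih =>
    rcases (ha n).2.lt_or_eq with h1 | h1
    · exact h n h1
    · have h2 := val_shift ha hq n
      have h3 : (a n : ℝ) = m := by exact_mod_cast h1
      nlinarith

/-- In a unique expansion, all tails after a digit smaller than `m` have value less than `1`. -/
lemma Uni.tail_lt (h : Uni m q a) (hq : 1 < q) (hqm : q ≤ m + 1) {p n : ℕ} (hp : a p ≠ m)
    (hn : p < n) : val q (TwoExpansions.shift n a) < 1 :=
  tail_lt_of_le h.1 hq hqm (fun n => (h.2 n).1)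
    ((h.2 p).1 (lt_of_le_of_ne (h.1 p).2 hp)) (Nat.succ_le_of_lt hn)

lemma Uni.mirror_tail_lt (h : Uni m q a) (hq : 1 < q) (hqm : q ≤ m + 1) {p n : ℕ} (hp : a p ≠ 0)
    (hn : p < n) : val q (TwoExpansions.mirror m (TwoExpansions.shift n a)) < 1 := by
  rw [mirror_shift]
  exact h.mirror.tail_lt hq hqm (p := p) (by simpa using hp) hn

/-- All tails of `a` and all their reflections have value at most `1`. -/
def Bal (m : ℕ) (q : ℝ) (a : ℕ → ℤ) : Prop :=
  Dig m a ∧ ∀ n, val q (shift n a) ≤ 1 ∧ val q (mirror m (shift n a)) ≤ 1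

lemma Bal.weakUni (h : Bal m q a) : WeakUni m q a :=
  ⟨h.1, fun n => ⟨fun _ => (h.2 (n + 1)).1, fun _ => (h.2 (n + 1)).2⟩⟩

lemma WeakUni.bal (h : WeakUni m q a) (hq : 1 < q) (hqm : q ≤ m + 1) (hv : val q a = 1) :
    Bal m q a := by
  have hle : ∀ n, val q (TwoExpansions.shift n a) ≤ 1 := fun n =>
    tail_le_of_le h.1 hq hqm (fun n => (h.2 n).1) (p := 0) (by simp [hv]) (Nat.zero_le n)
  have h0 : 0 < a 0 := by
    refine lt_of_le_of_ne (h.1 0).1 fun h0 => ?_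
    have h1 := val_head h.1 hq
    rw [hv, ← h0] at h1
    have := hle 1
    push_cast at h1
    linarith
  have hm1 : ∀ n, 1 ≤ n → val q (TwoExpansions.mirror m (TwoExpansions.shift n a)) ≤ 1 := by
    intro n hn
    rw [mirror_shift]
    exact tail_le_of_le h.mirror.1 hq hqm (fun n => (h.mirror.2 n).1) ((h.2 0).2 h0) hn
  refine ⟨h.1, fun n => ⟨hle n, ?_⟩⟩
  rcases Nat.eq_zero_or_pos n with rfl | hn
  · have h1 := hm1 1 le_rfl
    have h2 := hle 1
    rw [val_mirror (h.1.shift _) hq] at h1 ⊢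
    rw [shift_zero, hv]
    linarith
  · exact hm1 n hn

/-! ### Translation from `Digits` -/

/-- The integer-valued sequence of a digit sequence. -/
def toSeq (c : Digits m) : ℕ → ℤ := fun i => ((c i : ℕ) : ℤ)

lemma dig_toSeq (c : Digits m) : Dig m (toSeq c) := fun i => by
  have := (c i).is_lt
  simp only [toSeq]; omega

lemma toSeq_injective : Function.Injective (toSeq (m := m)) := fun c d h => by
  ext i
  have := congrFun h i
  simpa [toSeq] using this

lemma exists_toSeq (h : Dig m a) : ∃ c : Digits m, toSeq c = a := by
  refine ⟨fun i => ⟨(a i).toNat, ?_⟩, ?_⟩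
  · have := h i; omega
  · ext i
    have := h i
    simp [toSeq, this.1]

lemma isExpansion_iff (hq : 1 < q) (c : Digits m) (x : ℝ) :
    IsExpansion q c x ↔ val q (toSeq c) = x := by
  have h : IsExpansion q c x ↔ HasSum (fun i : ℕ => (toSeq c i : ℝ) / q ^ (i + 1)) x := by
    simp [IsExpansion, toSeq]
  rw [h]
  exact ⟨fun h => h.tsum_eq, fun h => h ▸ (dig_toSeq c).hasSum hq⟩

lemma toSeq_reflection (c : Digits m) : toSeq (reflection c) = mirror m (toSeq c) := by
  ext i
  have := (c i).is_lt
  simp only [toSeq, reflection, Fin.val_rev, mirror_apply]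
  omega

lemma isInfinite_iff (c : Digits m) :
    IsInfinite c ↔ ∀ n, toSeq c n ≠ 0 → ∃ k, n < k ∧ toSeq c k ≠ 0 := by
  have h0 : ∀ n, toSeq c n = 0 ↔ c n = 0 := fun n => by simp [toSeq]
  simp only [IsInfinite, ne_eq, h0]
  push Not
  rfl

/-- `U` in terms of `Uni`. -/
lemma mem_univoqueBases_iff :
    q ∈ univoqueBases m ↔ q ∈ Ioc (1 : ℝ) (m + 1) ∧ ∃ a, Uni m q a ∧ val q a = 1 := by
  refine and_congr_right fun hq => ?_
  constructor
  · rintro ⟨-, c, hc, hu⟩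
    have hc' : val q (toSeq c) = 1 := (isExpansion_iff hq.1 c 1).1 hc
    refine ⟨toSeq c, uni_of_unique (dig_toSeq c) hq.1 hq.2 fun b hb hv => ?_, hc'⟩
    obtain ⟨d, rfl⟩ := exists_toSeq hb
    rw [hu d ((isExpansion_iff hq.1 d 1).2 (hv.trans hc'))]
  · rintro ⟨a, ha, hv⟩
    obtain ⟨c, rfl⟩ := exists_toSeq ha.1
    refine ⟨⟨zero_le_one, one_le_max hq.1 hq.2⟩, c, (isExpansion_iff hq.1 c 1).2 hv,
      fun d hd => ?_⟩
    refine toSeq_injective (ha.eq_of_val_eq (dig_toSeq d) hq.1 ?_)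
    rw [hv, (isExpansion_iff hq.1 d 1).1 hd]

lemma mem_vBases_of_weakUni (hq : q ∈ Ioc (1 : ℝ) (m + 1)) (h : WeakUni m q a)
    (hv : val q a = 1) : q ∈ vBases m := by
  -- any doubly infinite expansion of `1` coincides with `a`
  have key : ∀ d : Digits m, IsExpansion q d 1 → IsDoublyInfinite d → toSeq d = a := by
    intro d hd hinf
    have hdv := (isExpansion_iff hq.1 d 1).1 hd
    have hdd := dig_toSeq d
    have hi1 := (isInfinite_iff d).1 hinf.1
    have hi2 := (isInfinite_iff _).1 hinf.2
    rw [toSeq_reflection] at hi2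
    by_contra hne
    obtain ⟨k, hk, hd⟩ := exists_first_diff (Ne.symm hne)
    have h1 := diff_eq_of_val_eq h.1 hdd hq.1 hk (hv.trans hdv.symm)
    rcases hd.lt_or_gt with hlt | hlt
    · have h2 := (h.2 k).1 (hlt.trans_le (hdd k).2)
      have h3 : (a k : ℝ) + 1 ≤ toSeq d k := by exact_mod_cast hlt
      obtain ⟨j, hj, hj0⟩ := hi1 k (by have := (h.1 k).1; omega)
      refine hj0 ?_
      have := eq_zero_of_val (hdd.shift (k + 1)) hq.1 (by linarith) (j - (k + 1))
      rwa [shift_apply, Nat.add_sub_cancel' (Nat.succ_le_of_lt hj)] at this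
    · have h2 := (h.2 k).2 ((hdd k).1.trans_lt hlt)
      rw [val_mirror (h.1.shift _) hq.1] at h2
      have h3 : (toSeq d k : ℝ) + 1 ≤ a k := by exact_mod_cast hlt
      obtain ⟨j, hj, hj0⟩ := hi2 k (by have := (h.1 k).2; simp only [mirror_apply]; omega)
      refine hj0 ?_
      have := eq_zero_of_val (hdd.shift (k + 1)).mirror hq.1
        (by rw [val_mirror (hdd.shift _) hq.1]; linarith) (j - (k + 1))
      rwa [mirror_apply, shift_apply, Nat.add_sub_cancel' (Nat.succ_le_of_lt hj)] at this
  refine ⟨hq, ⟨zero_le_one, one_le_max hq.1 hq.2⟩, ?_⟩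
  rintro c ⟨hc, hci⟩ d ⟨hd, hdi⟩
  exact toSeq_injective ((key c hc hci).trans (key d hd hdi).symm)

/-- For `q ∈ V` the quasi-greedy expansion of `1` is balanced: if a reflected tail had value larger
than `1`, lowering the digit in front of it would produce a second doubly infinite expansion. -/
lemma exists_bal_of_mem_vBases (h : q ∈ vBases m) : ∃ a, Bal m q a ∧ val q a = 1 := by
  obtain ⟨⟨hq, hqm⟩, -, hsub⟩ := h
  rcases hqm.lt_or_eq with hlt | heq
  · have hmax : 1 < (m : ℝ) / (q - 1) := by rw [lt_div_iff₀ (by linarith)]; linarith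
    obtain ⟨a, ha, hv, hpos, hle⟩ := exists_quasiGreedy hq hqm zero_lt_one hmax.le
    -- sequences arising from the quasi-greedy algorithm are doubly infinite
    have hfull : ∀ {e : ℕ → ℤ} {n : ℕ}, Dig m e → (∀ k, n ≤ k → e k = m) →
        val q (shift n e) = m / (q - 1) := by
      intro e n he hk
      have : shift n e = fun _ => (m : ℤ) := by ext i; exact hk _ (by omega)
      rw [this, val_const hq]; simp
    have hzero : ∀ {e : ℕ → ℤ} {n : ℕ}, (∀ k, n ≤ k → e k = 0) → val q (shift n e) = 0 := by
      intro e n hk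
      have : shift n e = fun _ => (0 : ℤ) := by ext i; exact hk _ (by omega)
      rw [this, val_zero]
    have hdi : ∀ c : Digits m, (∀ n, ¬ ∀ k, n ≤ k → toSeq c k = 0) →
        (∀ n, toSeq c n ≠ m → ¬ ∀ k, n < k → toSeq c k = m) → IsDoublyInfinite c := by
      intro c h1 h2
      refine ⟨(isInfinite_iff c).2 fun n _ => ?_, (isInfinite_iff _).2 fun n hn => ?_⟩
      · have := h1 (n + 1)
        push Not at this
        obtain ⟨k, hk, hk0⟩ := this
        exact ⟨k, hk, hk0⟩
      · rw [toSeq_reflection] at hn ⊢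
        have := h2 n (fun h => hn (by simp [h]))
        push Not at this
        obtain ⟨k, hk, hk0⟩ := this
        exact ⟨k, hk, fun h => hk0 (by simp only [mirror_apply] at h; omega)⟩
    have hweak : WeakUni m q a := by
      refine ⟨ha, fun n => ⟨hle n, fun hn => ?_⟩⟩
      by_contra! hc
      rw [val_mirror (ha.shift _) hq] at hc
      have hy0 := hpos (n + 1)
      obtain ⟨b, hb, hbv, hbpos, hble⟩ := exists_quasiGreedy hq hqm
        (x := val q (shift (n + 1) a) + 1) (by linarith) (by linarith)
      let d := glue (n + 1) (fun i => if i < n then a i else a n - 1) b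
      have hd : Dig m d := by
        refine Dig.glue (fun i _ => ?_) hb
        split_ifs
        · exact ha i
        · have := ha n; omega
      have hdn : d n = a n - 1 := by simp [d, glue]
      have hdv : val q d = 1 := by
        have h2 := val_sub_val hd ha hq (k := n)
          (fun i hi => by simp only [d]; rw [glue_of_lt _ _ (by omega)]; simp [hi])
        rw [hdn, show shift (n + 1) d = b from shift_glue _ _ _, hbv] at h2
        rw [← hv, ← sub_eq_zero, h2]
        push_cast; ring
      obtain ⟨ca, hca⟩ := exists_toSeq ha
      obtain ⟨cd, hcd⟩ := exists_toSeq hd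
      have h3 : ca = cd := by
        refine hsub ⟨(isExpansion_iff hq ca 1).2 (by rw [hca, hv]), hdi ca ?_ ?_⟩
          ⟨(isExpansion_iff hq cd 1).2 (by rw [hcd, hdv]), hdi cd ?_ ?_⟩
        · rw [hca]
          intro k hk
          exact (hpos k).ne' (hzero hk)
        · rw [hca]
          intro k hk hk'
          have := hle k (lt_of_le_of_ne (ha k).2 hk)
          rw [hfull (n := k + 1) ha hk'] at this
          linarith
        · rw [hcd]
          intro k hk
          refine (hbpos k).ne' (hzero fun j hj => ?_)
          have := hk (n + 1 + j) (by omega)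
          simpa [d] using this
        · rw [hcd]
          intro k hk hk'
          rcases Nat.lt_or_ge n k with hkn | hkn
          · obtain ⟨j, rfl⟩ := Nat.exists_eq_add_of_le (Nat.succ_le_of_lt hkn)
            simp only [d, Nat.succ_eq_add_one, glue_add] at hk
            have := hble j (lt_of_le_of_ne (hb j).2 hk)
            rw [hfull (n := j + 1) hb fun i hi => by
              have := hk' (n + 1 + i) (by omega)
              simpa [d] using this] at this
            linarith
          · have h4 : val q b = m / (q - 1) := by
              rw [← shift_zero b]
              refine hfull hb fun i _ => ?_
              have := hk' (n + 1 + i) (by omega)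
              simpa [d] using this
            linarith
      have h4 : a n = d n := by rw [← hca, ← hcd, h3]
      omega
    exact ⟨a, hweak.bal hq hqm hv, hv⟩
  · -- in base `m + 1` the expansion is `m m m ⋯`
    have hq1 : q - 1 = m := by linarith
    have hm0 : (0 : ℝ) < m := by linarith
    have hv : val q (fun _ => (m : ℤ)) = 1 := by
      rw [val_const hq, hq1]; push_cast; exact div_self hm0.ne'
    refine ⟨fun _ => m, ⟨fun _ => ⟨by positivity, le_rfl⟩, fun n => ⟨?_, ?_⟩⟩, hv⟩
    · exact hv.le
    · have : mirror m (shift n fun _ => (m : ℤ)) = fun _ => 0 := by ext i; simp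
      rw [this, val_zero]; exact zero_le_one

/-- A base in `B₂` solves `1 + val c = val d` with unique expansions `c` and `d`: these are the
tails after the first difference of the two expansions. -/
lemma exists_uni_of_mem_twoBases (h : q ∈ twoBases m) :
    ∃ c d, Uni m q c ∧ Uni m q d ∧ 1 + val q c = val q d := by
  obtain ⟨⟨hq, hqm⟩, x, -, hx⟩ := h
  obtain ⟨u, v, huv, huv'⟩ := Set.encard_eq_two.1 hx
  have hall : ∀ e, Dig m e → val q e = x → e = toSeq u ∨ e = toSeq v := by
    intro e he hev
    obtain ⟨c, rfl⟩ := exists_toSeq he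
    have : c ∈ {c : Digits m | IsExpansion q c x} := (isExpansion_iff hq c x).2 hev
    rw [huv'] at this
    rcases this with rfl | rfl
    · exact Or.inl rfl
    · exact Or.inr rfl
  have hu : val q (toSeq u) = x := (isExpansion_iff hq u x).1 <| by
    have : u ∈ ({u, v} : Set (Digits m)) := by simp
    rwa [← huv'] at this
  have hv : val q (toSeq v) = x := (isExpansion_iff hq v x).1 <| by
    have : v ∈ ({u, v} : Set (Digits m)) := by simp
    rwa [← huv'] at this
  have hne : toSeq u ≠ toSeq v := fun h => huv (toSeq_injective h)
  -- the statement is symmetric in the two expansions, so the order of the differing digits is free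
  have key : ∀ a b : ℕ → ℤ, Dig m a → Dig m b → val q a = x → val q b = x →
      (∀ e, Dig m e → val q e = x → e = a ∨ e = b) → ∀ k, (∀ i < k, a i = b i) → b k < a k →
      ∃ c d, Uni m q c ∧ Uni m q d ∧ 1 + val q c = val q d := by
    intro a b ha hb hav hbv hall k hk hlt
    have huni : ∀ a b : ℕ → ℤ, Dig m a → val q a = x →
        (∀ e, Dig m e → val q e = x → e = a ∨ e = b) → a k ≠ b k → Uni m q (shift (k + 1) a) := by
      intro a b ha hav hall hne
      refine uni_of_unique (ha.shift _) hq hqm fun e he hev => ?_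
      have hg : Dig m (glue (k + 1) a e) := Dig.glue (fun i _ => ha i) he
      have hgv : val q (glue (k + 1) a e) = x := by
        rw [val_glue hg hq, hev, ← val_split ha hq (k + 1), hav]
      rcases hall _ hg hgv with h1 | h1
      · rw [← h1, shift_glue]
      · exfalso
        have := congrFun h1 k
        rw [glue_of_lt _ _ (by omega)] at this
        exact hne this
    have hdiff := diff_eq_of_val_eq ha hb hq hk (hav.trans hbv.symm)
    have hone : a k = b k + 1 := by
      by_contra hc
      have h2 : b k + 2 ≤ a k := by omega
      have h3 : (b k : ℝ) + 2 ≤ a k := by exact_mod_cast h2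
      have h4 := val_nonneg (ha.shift (k + 1)) hq
      have h5 := val_le (hb.shift (k + 1)) hq
      obtain ⟨e, he, hev, hek⟩ := exists_replace hb hq hqm k (x := b k + 1)
        (by have := (hb k).1; omega) (by have := (ha k).2; omega)
        (by push_cast; linarith) (by push_cast; linarith)
      rcases hall e he (hev.trans hbv) with rfl | rfl <;> omega
    refine ⟨_, _, huni a b ha hav hall (by omega),
      huni b a hb hbv (fun e he hev => (hall e he hev).symm) (by omega), ?_⟩
    rw [hone] at hdiff
    push_cast at hdiff
    linarith
  obtain ⟨k, hk, hd⟩ := exists_first_diff hne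
  rcases hd.lt_or_gt with hlt | hlt
  · exact key _ _ (dig_toSeq v) (dig_toSeq u) hv hu (fun e he hev => (hall e he hev).symm) k
      (fun i hi => (hk i hi).symm) hlt
  · exact key _ _ (dig_toSeq u) (dig_toSeq v) hu hv hall k hk hlt

/-- The converse of `exists_uni_of_mem_twoBases`. As `m / (q - 1) < 2`, no expansion of `val d / q`
starts with a digit larger than `1`. -/
lemma mem_twoBases (hq : 1 < q) (hqm : q ≤ m + 1) (hbig : m < 2 * (q - 1)) {c d : ℕ → ℤ}
    (hc : Uni m q c) (hd : Uni m q d) (h : 1 + val q c = val q d) : q ∈ twoBases m := by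
  have hm1 : (1 : ℤ) ≤ m := by
    have : (0 : ℝ) < m := by linarith
    have : 0 < m := by exact_mod_cast this
    omega
  have hq0 : 0 < q := by linarith
  have hlt2 : (m : ℝ) / (q - 1) < 2 := by rw [div_lt_iff₀ (by linarith)]; linarith
  have hdle := val_le hd.1 hq
  have hd0 := val_nonneg hd.1 hq
  have hD : Dig m (glue 1 (fun _ => 0) d) := Dig.glue (fun _ _ => ⟨le_rfl, by omega⟩) hd.1
  have hC : Dig m (glue 1 (fun _ => 1) c) := Dig.glue (fun _ _ => ⟨by omega, by omega⟩) hc.1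
  have hDv : val q (glue 1 (fun _ => 0) d) = val q d / q := by
    rw [val_glue hD hq]; simp
  have hCv : val q (glue 1 (fun _ => 1) c) = val q d / q := by
    rw [val_glue hC hq, ← h]; simp; ring
  obtain ⟨u, hu⟩ := exists_toSeq hD
  obtain ⟨v, hv⟩ := exists_toSeq hC
  refine ⟨⟨hq, hqm⟩, val q d / q, ⟨by positivity, ?_⟩, ?_⟩
  · rw [div_le_iff₀ hq0]
    have : 0 ≤ (m : ℝ) / (q - 1) := hd0.trans hdle
    nlinarith
  · refine Set.encard_eq_two.2 ⟨u, v, ?_, ?_⟩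
    · rintro rfl
      have := congrFun (hu.symm.trans hv) 0
      simp [glue] at this
    · ext e
      simp only [mem_ofPred_eq, mem_insert_iff, mem_singleton_iff]
      rw [isExpansion_iff hq]
      constructor
      · intro he
        have h1 := val_head (dig_toSeq e) hq
        rw [he, mul_div_cancel₀ _ hq0.ne'] at h1
        have h2 := val_nonneg ((dig_toSeq e).shift 1) hq
        have h3 : toSeq e 0 < 2 := by
          by_contra! hcon
          have : (2 : ℝ) ≤ toSeq e 0 := by exact_mod_cast hcon
          linarith
        have h4 := (dig_toSeq e 0).1
        have h5 : toSeq e 0 = 0 ∨ toSeq e 0 = 1 := by omega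
        rcases h5 with h5 | h5
        · left
          have h6 := hd.eq_of_val_eq ((dig_toSeq e).shift 1) hq (by rw [h1, h5]; simp)
          refine toSeq_injective ?_
          rw [hu, ← glue_eq_self 1 (toSeq e), h6]
          ext i; rcases i with _ | i <;> simp [glue, h5]
        · right
          have h6 := hc.eq_of_val_eq ((dig_toSeq e).shift 1) hq (by
            rw [h5] at h1; push_cast at h1; linarith)
          refine toSeq_injective ?_
          rw [hv, ← glue_eq_self 1 (toSeq e), h6]
          ext i; rcases i with _ | i <;> simp [glue, h5]
      · rintro (rfl | rfl)
        · rw [hu, hDv]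
        · rw [hv, hCv]

/-! ### Limits of bases in `B₂` -/

lemma tendsto_shift {ι : Type*} {l : Filter ι} {as : ι → ℕ → ℤ} (h : Tendsto as l (𝓝 a)) (n : ℕ) :
    Tendsto (fun k => shift n (as k)) l (𝓝 (shift n a)) :=
  tendsto_pi_nhds.2 fun i => (tendsto_pi_nhds.1 h) (n + i)

lemma tendsto_mirror {ι : Type*} {l : Filter ι} {as : ι → ℕ → ℤ} (h : Tendsto as l (𝓝 a)) :
    Tendsto (fun k => mirror m (as k)) l (𝓝 (mirror m a)) :=
  tendsto_pi_nhds.2 fun i => tendsto_const_nhds.sub ((tendsto_pi_nhds.1 h) i)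

lemma eventually_eq_of_tendsto {ι : Type*} {l : Filter ι} {as : ι → ℕ → ℤ}
    (h : Tendsto as l (𝓝 a)) (i : ℕ) : ∀ᶠ k in l, as k i = a i := by
  have h1 := (tendsto_pi_nhds.1 h) i
  rwa [nhds_discrete, tendsto_pure] at h1

lemma weakUni_of_tendsto {qs : ℕ → ℝ} {as : ℕ → ℕ → ℤ} (hq : 1 < q)
    (hqs : Tendsto qs atTop (𝓝 q)) (h : Tendsto as atTop (𝓝 a)) (hu : ∀ k, Uni m (qs k) (as k)) :
    WeakUni m q a := by
  have hd : ∀ k, Dig m (as k) := fun k => (hu k).1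
  refine ⟨fun i => ?_, fun n => ⟨fun hn => ?_, fun hn => ?_⟩⟩
  · obtain ⟨k, hk⟩ := (eventually_eq_of_tendsto h i).exists
    rw [← hk]; exact hd k i
  · refine le_of_tendsto (tendsto_val hq hqs (fun k => (hd k).shift (n + 1)) (tendsto_shift h _)) ?_
    filter_upwards [eventually_eq_of_tendsto h n] with k hk
    exact (((hu k).2 n).1 (by rwa [hk])).le
  · refine le_of_tendsto (tendsto_val hq hqs (fun k => ((hd k).shift (n + 1)).mirror)
      (tendsto_mirror (tendsto_shift h _))) ?_
    filter_upwards [eventually_eq_of_tendsto h n] with k hk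
    exact (((hu k).2 n).2 (by rwa [hk])).le

lemma exists_subseq_tendsto {as : ℕ → ℕ → ℤ} (h : ∀ k, Dig m (as k)) :
    ∃ a, ∃ φ : ℕ → ℕ, StrictMono φ ∧ Tendsto (as ∘ φ) atTop (𝓝 a) := by
  have hc : IsCompact (Set.pi univ fun _ : ℕ => Icc (0 : ℤ) m) :=
    isCompact_univ_pi fun _ => isCompact_Icc
  obtain ⟨a, -, φ, hφ, ht⟩ := hc.tendsto_subseq (x := as) fun k => by
    simp only [Set.mem_pi, mem_univ, mem_Icc, forall_const]; exact h k
  exact ⟨a, φ, hφ, ht⟩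

/-- An accumulation point `q` of `B₂` is a limit of bases `≠ q` in `B₂` for which the two unique
expansions in `1 + val c = val d` converge as well. -/
lemma exists_seq_of_accPt (h : AccPt q (𝓟 (twoBases m))) :
    ∃ (qs : ℕ → ℝ) (cs ds : ℕ → ℕ → ℤ) (c d : ℕ → ℤ), Tendsto qs atTop (𝓝 q) ∧
      Tendsto cs atTop (𝓝 c) ∧ Tendsto ds atTop (𝓝 d) ∧
      ∀ n, qs n ≠ q ∧ qs n ∈ Ioc (1 : ℝ) (m + 1) ∧ Uni m (qs n) (cs n) ∧ Uni m (qs n) (ds n) ∧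
        1 + val (qs n) (cs n) = val (qs n) (ds n) := by
  obtain ⟨qs, hqs, hmem⟩ := exists_seq_forall_of_frequently (accPt_iff_frequently.1 h)
  choose cs ds hcs hds heq using fun n => exists_uni_of_mem_twoBases (hmem n).2
  obtain ⟨c, φ, hφ, hc⟩ := exists_subseq_tendsto fun k => (hcs k).1
  obtain ⟨d, ψ, hψ, hd⟩ := exists_subseq_tendsto fun k => (hds (φ k)).1
  refine ⟨qs ∘ φ ∘ ψ, cs ∘ φ ∘ ψ, ds ∘ φ ∘ ψ, c, d,
    hqs.comp (hφ.comp hψ).tendsto_atTop, hc.comp hψ.tendsto_atTop, hd, fun n => ?_⟩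
  exact ⟨(hmem _).1, (hmem _).2.1, hcs _, hds _, heq _⟩

lemma tendsto_val_eq {qs : ℕ → ℝ} {cs ds : ℕ → ℕ → ℤ} {c d : ℕ → ℤ} (hq : 1 < q)
    (hqs : Tendsto qs atTop (𝓝 q)) (hc : Tendsto cs atTop (𝓝 c)) (hd : Tendsto ds atTop (𝓝 d))
    (hcs : ∀ n, Dig m (cs n)) (hds : ∀ n, Dig m (ds n))
    (h : ∀ n, 1 + val (qs n) (cs n) = val (qs n) (ds n)) : 1 + val q c = val q d :=
  tendsto_nhds_unique ((tendsto_val hq hqs hcs hc).const_add 1)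
    ((tendsto_val hq hqs hds hd).congr fun n => (h n).symm)

/-- Outside `V` the weak and the strict conditions agree: a tail attaining equality would be an
expansion of `1` satisfying the weak condition. -/
lemma WeakUni.uni_of_notMem (hq : q ∈ Ioc (1 : ℝ) (m + 1)) (hV : q ∉ vBases m)
    (h : WeakUni m q a) : Uni m q a := by
  refine ⟨h.1, fun n => ⟨fun hn => lt_of_le_of_ne ((h.2 n).1 hn) fun he => ?_,
    fun hn => lt_of_le_of_ne ((h.2 n).2 hn) fun he => ?_⟩⟩
  · exact hV (mem_vBases_of_weakUni hq (h.shift _) he)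
  · exact hV (mem_vBases_of_weakUni hq (h.shift _).mirror he)

lemma mem_twoBases_of_accPt (hq : q ∈ Ioc (1 : ℝ) (m + 1)) (hbig : m < 2 * (q - 1))
    (hV : q ∉ vBases m) (h : AccPt q (𝓟 (twoBases m))) : q ∈ twoBases m := by
  obtain ⟨qs, cs, ds, c, d, hqs, hc, hd, hall⟩ := exists_seq_of_accPt h
  have hcu := (weakUni_of_tendsto hq.1 hqs hc fun n => (hall n).2.2.1).uni_of_notMem hq hV
  have hdu := (weakUni_of_tendsto hq.1 hqs hd fun n => (hall n).2.2.2.1).uni_of_notMem hq hV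
  exact mem_twoBases hq.1 hq.2 hbig hcu hdu (tendsto_val_eq hq.1 hqs hc hd
    (fun n => (hall n).2.2.1.1) (fun n => (hall n).2.2.2.1.1) fun n => (hall n).2.2.2.2)

/-! ### A lower bound for `B₂` -/

lemma Uni.two_mul_gt (h : Uni m q a) (hq : 1 < q) (hqm : q ≤ m + 1) {p p' : ℕ} (hp : a p ≠ 0)
    (hp' : a p' ≠ m) : m < 2 * (q - 1) := by
  have h1 := h.tail_lt hq hqm hp' (n := max p p' + 1) (by omega)
  have h2 := h.mirror_tail_lt hq hqm hp (n := max p p' + 1) (by omega)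
  rw [val_mirror (h.1.shift _) hq] at h2
  have h3 : (m : ℝ) / (q - 1) < 2 := by linarith
  rwa [div_lt_iff₀ (by linarith)] at h3

/-- If neither of the two sequences differs from both `0^∞` and `m^∞`, they are `0^∞` and `m^∞`,
and the base is `m + 1`. -/
lemma two_mul_gt_of_mem_twoBases (hm : 1 ≤ m) (h : q ∈ twoBases m) : m < 2 * (q - 1) := by
  obtain ⟨c, d, hc, hd, heq⟩ := exists_uni_of_mem_twoBases h
  obtain ⟨⟨hq, hqm⟩, -⟩ := h
  have hm' : (1 : ℝ) ≤ m := by exact_mod_cast hm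
  by_cases h1 : ∃ p, d p ≠ 0
  · obtain ⟨p, hp⟩ := h1
    by_cases h2 : ∃ p, d p ≠ m
    · obtain ⟨p', hp'⟩ := h2
      exact hd.two_mul_gt hq hqm hp hp'
    · push Not at h2
      by_cases h3 : ∃ p, c p ≠ 0
      · obtain ⟨p, hp⟩ := h3
        by_cases h4 : ∃ p, c p ≠ m
        · obtain ⟨p', hp'⟩ := h4
          exact hc.two_mul_gt hq hqm hp hp'
        · push Not at h4
          rw [show c = d by ext i; rw [h2, h4]] at heq
          linarith
      · push Not at h3
        rw [show c = fun _ => 0 from funext h3, show d = fun _ => (m : ℤ) from funext h2, val_zero,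
          val_const hq] at heq
        push_cast at heq
        rw [add_zero, eq_div_iff (by linarith)] at heq
        linarith
  · push Not at h1
    rw [show d = fun _ => 0 from funext h1, val_zero] at heq
    have := val_nonneg hc.1 hq
    linarith

lemma two_mul_ge_of_accPt (hm : 1 ≤ m) (h : AccPt q (𝓟 (twoBases m))) : m ≤ 2 * (q - 1) := by
  have h1 : twoBases m ⊆ {q : ℝ | (m : ℝ) ≤ 2 * (q - 1)} := fun x hx =>
    (two_mul_gt_of_mem_twoBases hm hx).le
  have h2 : IsClosed {q : ℝ | (m : ℝ) ≤ 2 * (q - 1)} :=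
    isClosed_le continuous_const (by fun_prop)
  exact closure_minimal h1 h2 (mem_closure_iff_clusterPt.2 h.clusterPt)

/-! ### Bases below `q_f` -/

/-- `Q` is the base `q_f(m)`, given by its polynomial equation and its location. -/
def IsQf (m : ℕ) (Q : ℝ) : Prop :=
  ∃ k : ℕ, (k : ℝ) + 1 < Q ∧ Q < k + 2 ∧
    ((m = 2 * k ∧ 1 ≤ k ∧ Q ^ 2 - (k + 1) * Q - k = 0) ∨
      (m = 2 * k + 1 ∧ Q ^ 3 - (k + 2) * Q ^ 2 + Q - k - 1 = 0))

lemma IsQf.two_mul_gt {Q : ℝ} (h : IsQf m Q) : m < 2 * (Q - 1) := by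
  obtain ⟨k, h1, h2, ⟨rfl, -, h3⟩ | ⟨rfl, h3⟩⟩ := h
  · push_cast; linarith
  · push_cast
    by_contra! hc
    have hk : (0 : ℝ) ≤ k := by positivity
    have h4 : Q ^ 2 * (k + 2 - Q) = Q - k - 1 := by linarith
    nlinarith [mul_pos (show (0 : ℝ) < Q by linarith) (show (0 : ℝ) < Q by linarith)]

lemma IsQf.one_lt {Q : ℝ} (h : IsQf m Q) : 1 < Q := by
  obtain ⟨k, h1, -⟩ := h
  have hk : (0 : ℝ) ≤ k := by positivity
  linarith

lemma IsQf.lt {Q : ℝ} (h : IsQf m Q) : Q < m + 1 := by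
  obtain ⟨k, h1, h2, ⟨rfl, h3, -⟩ | ⟨rfl, h3⟩⟩ := h
  · have : (1 : ℝ) ≤ k := by exact_mod_cast h3
    push_cast; linarith
  · have hk : (0 : ℝ) ≤ k := by positivity
    push_cast; linarith

/-- The sequences `k^∞` (for `m = 2k`), respectively `(k (k+1))^∞` and `((k+1) k)^∞`
(for `m = 2k + 1`). -/
def Alternating (m : ℕ) (t : ℕ → ℤ) : Prop :=
  (m - 1 ≤ 2 * t 0 ∧ 2 * t 0 ≤ m + 1) ∧ ∀ i, t (i + 1) = m - t i

lemma Alternating.ext (ha : Alternating m a) (hb : Alternating m b) (h : a 0 = b 0) : a = b := by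
  ext i
  induction i with
  | zero => exact h
  | succ i ih => rw [ha.2, hb.2, ih]

lemma digit_lt_of_val_lt (ha : Dig m a) (hq : 1 < q) {x : ℤ} (hx : q ≤ x) {n : ℕ}
    (h : val q (shift n a) < 1) : a n < x := by
  have h1 := val_shift ha hq n
  have h2 := val_nonneg (ha.shift (n + 1)) hq
  have h3 : (a n : ℝ) < x := by nlinarith
  exact_mod_cast h3

/-- In base `q_f` every other sequence has a tail, or a reflected tail, of value at least `1`. -/
lemma alternating_of_tails_lt {Q : ℝ} (hQ : IsQf m Q) (ha : Dig m a)
    (h : ∀ n, val Q (shift n a) < 1 ∧ val Q (mirror m (shift n a)) < 1) : Alternating m a := by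
  have hQ1 := hQ.one_lt
  have hqm := hQ.lt
  obtain ⟨k, h1, h2, hcase⟩ := hQ
  have hk : (0 : ℝ) ≤ k := by positivity
  rcases hcase with ⟨rfl, hk1, heq⟩ | ⟨rfl, heq⟩
  · -- a digit larger than `k` would force the next tail below its lower bound
    have key : ∀ b, Dig (2 * k) b →
        (∀ n, val Q (shift n b) < 1 ∧ val Q (mirror (2 * k) (shift n b)) < 1) → ∀ n, b n ≤ k := by
      intro b hb h n
      by_contra! hc
      have h3 := val_shift hb hQ1 n
      have h4 := (h n).1
      have h5 := (h (n + 1)).2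
      rw [val_mirror (hb.shift _) hQ1] at h5
      have h6 : (k : ℝ) + 1 ≤ b n := by exact_mod_cast hc
      have h7 : ((2 * k : ℕ) : ℝ) / (Q - 1) < 1 + (Q - (k + 1)) := by nlinarith
      rw [div_lt_iff₀ (by linarith)] at h7
      push_cast at h7
      nlinarith
    have hle := key a ha h
    have hge := key (mirror (2 * k) a) ha.mirror fun n =>
      ⟨(h n).2, by rw [← mirror_shift, mirror_mirror]; exact (h n).1⟩
    have hall : ∀ n, a n = k := fun n => by
      have h3 := hle n
      have h4 := hge n
      simp only [mirror_apply] at h4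
      push_cast at h4
      omega
    refine ⟨?_, fun i => ?_⟩
    · rw [hall 0]; push_cast; omega
    · rw [hall, hall]; push_cast; omega
  · have key : ∀ b, Dig (2 * k + 1) b →
        (∀ n, val Q (shift n b) < 1 ∧ val Q (mirror (2 * k + 1) (shift n b)) < 1) →
        ∀ n, b n ≤ k + 1 ∧ (b n = k + 1 → b (n + 1) ≤ k) := by
      intro b hb h
      have hb2 : ∀ n, b n ≤ k + 1 := fun n => by
        have := digit_lt_of_val_lt hb hQ1 (x := k + 2) (by push_cast; linarith) (h n).1
        omega
      refine fun n => ⟨hb2 n, fun hn => ?_⟩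
      by_contra! hc
      have h3 := val_shift hb hQ1 n
      have h4 := val_shift hb hQ1 (n + 1)
      have h5 := (h n).1
      have h6 := (h (n + 1 + 1)).2
      rw [val_mirror (hb.shift _) hQ1] at h6
      have h7 : (k : ℝ) + 1 ≤ b (n + 1) := by exact_mod_cast hc
      rw [hn] at h3
      push_cast at h3
      have h8 : val Q (shift (n + 1 + 1) b) < Q * (Q - (k + 1)) - (k + 1) := by
        have h10 : val Q (shift (n + 1) b) < Q - (k + 1) := by nlinarith
        have h11 := mul_lt_mul_of_pos_left h10 (show (0 : ℝ) < Q by linarith)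
        linarith
      have h9 : ((2 * k + 1 : ℕ) : ℝ) / (Q - 1) < 1 + (Q * (Q - (k + 1)) - (k + 1)) := by linarith
      rw [div_lt_iff₀ (by linarith)] at h9
      push_cast at h9
      nlinarith
    have hle := key a ha h
    have hge := key (mirror (2 * k + 1) a) ha.mirror fun n =>
      ⟨(h n).2, by rw [← mirror_shift, mirror_mirror]; exact (h n).1⟩
    simp only [mirror_apply] at hge
    push_cast at hge
    refine ⟨?_, fun i => ?_⟩
    · have h3 := (hle 0).1
      have h4 := (hge 0).1
      push_cast; omega
    · have h3 := hle i
      have h4 := hge i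
      have h5 := hle (i + 1)
      have h6 := hge (i + 1)
      push_cast; omega

/-- For bases below `q_f`, unique expansions other than `0^∞` and `m^∞` are isolated. -/
lemma eventually_eq_of_tendsto_uni {Q : ℝ} (hQ : IsQf m Q) {as : ℕ → ℕ → ℤ}
    (h : Tendsto as atTop (𝓝 a)) (hu : ∀ᶠ n in atTop, Uni m Q (as n)) {p p' : ℕ} (hp : a p ≠ 0)
    (hp' : a p' ≠ m) : ∀ᶠ n in atTop, as n = a := by
  set K := max p p' + 1 with hK
  have hev : ∀ᶠ n in atTop, Uni m Q (as n) ∧ ∀ i ∈ Finset.range (K + 1), as n i = a i :=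
    hu.and ((Finset.eventually_all _).2 fun i _ => eventually_eq_of_tendsto h i)
  have halt : ∀ e, Uni m Q e → (∀ i ∈ Finset.range (K + 1), e i = a i) →
      Alternating m (shift K e) := by
    intro e he hea
    refine alternating_of_tails_lt hQ (he.1.shift K) fun n => ?_
    rw [shift_shift]
    have h1 : e p ≠ 0 := by rwa [hea p (Finset.mem_range.2 (by omega))]
    have h2 : e p' ≠ m := by rwa [hea p' (Finset.mem_range.2 (by omega))]
    exact ⟨he.tail_lt hQ.one_lt hQ.lt.le h2 (by omega),
      he.mirror_tail_lt hQ.one_lt hQ.lt.le h1 (by omega)⟩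
  obtain ⟨N, hN1, hN2⟩ := hev.exists
  have hconst : ∀ᶠ n in atTop, as n = as N := by
    filter_upwards [hev] with n hn
    have h3 : shift K (as n) = shift K (as N) := by
      refine (halt _ hn.1 hn.2).ext (halt _ hN1 hN2) ?_
      simp only [shift_apply, add_zero]
      rw [hn.2 K (by simp), hN2 K (by simp)]
    ext i
    by_cases hi : i < K
    · rw [hn.2 i (Finset.mem_range.2 (by omega)), hN2 i (Finset.mem_range.2 (by omega))]
    · obtain ⟨j, rfl⟩ := Nat.exists_eq_add_of_le (not_lt.1 hi)
      exact congrFun h3 j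
  have hlim : a = as N :=
    tendsto_nhds_unique h (tendsto_const_nhds.congr' (hconst.mono fun n hn => hn.symm))
  rw [hlim]
  exact hconst

/-- `1 + val q c = val q d` has only isolated solutions `q`: in the variable `1 / q` the difference
of the two sides is a power series with constant term `1`. -/
lemma false_of_tendsto_val_eq {qs : ℕ → ℝ} {c d : ℕ → ℤ} (hc : Dig m c) (hd : Dig m d) (hq : 1 < q)
    (hqs : Tendsto qs atTop (𝓝 q)) (hne : ∀ n, qs n ≠ q)
    (h : ∀ᶠ n in atTop, 1 + val (qs n) c = val (qs n) d) : False := by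
  obtain ⟨ρ, hρ1, hρq⟩ := exists_between hq
  have hρ0 : 0 < ρ := by linarith
  have hq0 : 0 < q := by linarith
  let f : ℂ → ℂ := fun z => ∑' i : ℕ, ((d i - c i : ℤ) : ℂ) * z ^ (i + 1)
  let U := Metric.ball (0 : ℂ) ρ⁻¹
  have hdiff : DifferentiableOn ℂ f U := by
    refine Complex.differentiableOn_tsum_of_summable_norm
      (u := fun i : ℕ => (m : ℝ) / ρ ^ (i + 1)) (hasSum_const_digit hρ1 m).summable (fun i => ?_)
      Metric.isOpen_ball fun i z hz => ?_
    · fun_prop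
    · rw [norm_mul, norm_pow, div_eq_mul_inv, ← inv_pow]
      have hz' : ‖z‖ ≤ ρ⁻¹ := by
        have := Metric.mem_ball.1 hz
        rw [dist_zero_right] at this
        exact this.le
      have h1 : ‖((d i - c i : ℤ) : ℂ)‖ ≤ m := by
        rw [Complex.norm_intCast]
        have := hc i
        have := hd i
        exact_mod_cast abs_le.2 ⟨by omega, by omega⟩
      gcongr
  have han : AnalyticOnNhd ℂ (fun z => f z - 1) U :=
    (hdiff.sub (differentiableOn_const 1)).analyticOnNhd Metric.isOpen_ball
  have hval : ∀ p : ℝ, 1 < p → f ((p⁻¹ : ℝ) : ℂ) = ((val p d - val p c : ℝ) : ℂ) := by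
    intro p hp
    have h1 := (hd.hasSum hp).sub (hc.hasSum hp)
    have h2 : HasSum (fun i : ℕ => ((d i - c i : ℤ) : ℂ) * ((p⁻¹ : ℝ) : ℂ) ^ (i + 1))
        ((val p d - val p c : ℝ) : ℂ) := by
      convert Complex.hasSum_ofReal.2 h1 using 1
      funext i
      push_cast
      rw [inv_pow]
      ring
    exact h2.tsum_eq
  have hmem : ((q⁻¹ : ℝ) : ℂ) ∈ U := by
    simp only [U, Metric.mem_ball, dist_zero_right, Complex.norm_real, Real.norm_eq_abs]
    rw [abs_of_pos (by positivity)]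
    gcongr
  have htend : Tendsto (fun n => (((qs n)⁻¹ : ℝ) : ℂ)) atTop (𝓝[≠] ((q⁻¹ : ℝ) : ℂ)) := by
    refine tendsto_nhdsWithin_iff.2 ⟨?_, Eventually.of_forall fun n => ?_⟩
    · exact (Complex.continuous_ofReal.tendsto _).comp (hqs.inv₀ hq0.ne')
    · simpa using hne n
  have hfreq : ∃ᶠ z in 𝓝[≠] ((q⁻¹ : ℝ) : ℂ), f z - 1 = 0 := by
    refine htend.frequently (Eventually.frequently ?_)
    filter_upwards [h, hqs.eventually (lt_mem_nhds hq)] with n hn hn1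
    rw [hval _ hn1, ← hn]
    push_cast
    ring
  have hz := han.eqOn_zero_of_preconnected_of_frequently_eq_zero
    (convex_ball (0 : ℂ) ρ⁻¹).isPreconnected hmem hfreq
    (Metric.mem_ball_self (by positivity) : (0 : ℂ) ∈ U)
  have hf0 : f 0 = 0 := by simp [f]
  simp [hf0] at hz

/-- A limit of values `≥ 1` of unique expansions cannot be `1` in a base below `q_f`. -/
lemma false_of_tendsto_val_one {Q : ℝ} (hQ : IsQf m Q) (hm : 1 ≤ m) {qs : ℕ → ℝ}
    {ds : ℕ → ℕ → ℤ} {d : ℕ → ℤ} (hq : 1 < q) (hqQ : q < Q) (hqs : Tendsto qs atTop (𝓝 q))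
    (hqs1 : ∀ n, 1 < qs n) (hds : Tendsto ds atTop (𝓝 d)) (hu : ∀ n, Uni m (qs n) (ds n))
    (h1 : ∀ n, 1 ≤ val (qs n) (ds n)) (hv : val q d = 1) : False := by
  have hqm : q ≤ m + 1 := (hqQ.trans hQ.lt).le
  have hbal := (weakUni_of_tendsto hq hqs hds hu).bal hq hqm hv
  have hlt : ∀ b, Dig m b → val q b ≤ 1 → val Q b < 1 := by
    intro b hb hb1
    rcases (val_nonneg hb hq).eq_or_lt with h0 | h0
    · have := val_anti hb hq hqQ.le
      linarith
    · exact (val_strictAnti hb hq hqQ h0).trans_le hb1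
  have halt : Alternating m d := alternating_of_tails_lt hQ hbal.1 fun n =>
    ⟨hlt _ (hbal.1.shift n) (hbal.2 n).1, hlt _ (hbal.1.shift n).mirror (hbal.2 n).2⟩
  obtain ⟨p, hp⟩ : ∃ p, d p ≠ 0 := by
    by_contra! hc
    rw [show d = fun _ => 0 from funext hc, val_zero] at hv
    norm_num at hv
  obtain ⟨p', hp'⟩ : ∃ p, d p ≠ m := by
    by_contra! hc
    rw [show d = fun _ => (m : ℤ) from funext hc, val_const hq, div_eq_one_iff_eq (by linarith)]
      at hv
    have := hQ.lt
    push_cast at hv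
    linarith
  have hev : ∀ᶠ n in atTop, Uni m Q (ds n) := by
    filter_upwards [hqs.eventually (gt_mem_nhds hqQ)] with n hn
    exact (hu n).mono (hqs1 n) hn.le
  obtain ⟨n, hn⟩ := (eventually_eq_of_tendsto_uni hQ hds hev hp hp').exists
  have hun := hu n
  have h1n := h1 n
  rw [hn] at hun h1n
  have hd1 := halt.2 0
  have hd0 := hbal.1 0
  rcases (hbal.1 1).2.lt_or_eq with h2 | h2
  · have h3 := (hun.2 1).1 h2
    have h4 : shift (1 + 1) d = d := by
      ext i
      rw [shift_apply, show 1 + 1 + i = i + 1 + 1 by ring, halt.2, halt.2]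
      ring
    rw [h4] at h3
    linarith
  · have h3 := (hun.2 0).1 (by rw [zero_add] at hd1; omega)
    have h4 := val_head hbal.1 (hqs1 n)
    have h5 : d 0 = 0 := by rw [zero_add] at hd1; omega
    rw [zero_add] at h3
    rw [h5] at h4
    push_cast at h4
    nlinarith [hqs1 n]

/-- `B₂` has no accumulation point below `q_f`. -/
lemma le_of_accPt {Q : ℝ} (hQ : IsQf m Q) (hm : 1 ≤ m) (h : AccPt q (𝓟 (twoBases m))) : Q ≤ q := by
  by_contra! hqQ
  have hbig := two_mul_ge_of_accPt hm h
  have hm' : (1 : ℝ) ≤ m := by exact_mod_cast hm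
  have hq : 1 < q := by linarith
  obtain ⟨qs, cs, ds, c, d, hqs, hc, hd, hall⟩ := exists_seq_of_accPt h
  have hcu := weakUni_of_tendsto hq hqs hc fun n => (hall n).2.2.1
  have hdu := weakUni_of_tendsto hq hqs hd fun n => (hall n).2.2.2.1
  have heq := tendsto_val_eq hq hqs hc hd
    (fun n => (hall n).2.2.1.1) (fun n => (hall n).2.2.2.1.1) fun n => (hall n).2.2.2.2
  have hqs1 : ∀ n, 1 < qs n := fun n => (hall n).2.1.1
  have hev : ∀ {as : ℕ → ℕ → ℤ}, (∀ n, Uni m (qs n) (as n)) → ∀ᶠ n in atTop, Uni m Q (as n) := by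
    intro as has
    filter_upwards [hqs.eventually (gt_mem_nhds hqQ)] with n hn
    exact (has n).mono (hqs1 n) hn.le
  have hc0 := val_nonneg hcu.1 hq
  have hdm := val_le hdu.1 hq
  obtain ⟨p₁, hp₁⟩ : ∃ p, d p ≠ 0 := by
    by_contra! hcon
    rw [show d = fun _ => 0 from funext hcon, val_zero] at heq
    linarith
  obtain ⟨p₂, hp₂⟩ : ∃ p, c p ≠ m := by
    by_contra! hcon
    rw [show c = fun _ => (m : ℤ) from funext hcon, val_const hq] at heq
    push_cast at heq
    linarith
  by_cases h3 : ∃ p, c p ≠ 0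
  · obtain ⟨p₃, hp₃⟩ := h3
    by_cases h4 : ∃ p, d p ≠ m
    · obtain ⟨p₄, hp₄⟩ := h4
      refine false_of_tendsto_val_eq hcu.1 hdu.1 hq hqs (fun n => (hall n).1) ?_
      filter_upwards [eventually_eq_of_tendsto_uni hQ hc (hev fun n => (hall n).2.2.1) hp₃ hp₂,
        eventually_eq_of_tendsto_uni hQ hd (hev fun n => (hall n).2.2.2.1) hp₁ hp₄] with n hn1 hn2
      rw [← hn1, ← hn2]
      exact (hall n).2.2.2.2
    · push Not at h4
      refine false_of_tendsto_val_one hQ hm hq hqQ hqs hqs1 (tendsto_mirror (m := m) hc)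
        (fun n => (hall n).2.2.1.mirror) (fun n => ?_) ?_
      · rw [val_mirror (hall n).2.2.1.1 (hqs1 n)]
        have h5 := val_le (hall n).2.2.2.1.1 (hqs1 n)
        have h6 := (hall n).2.2.2.2
        linarith
      · rw [val_mirror hcu.1 hq]
        rw [show d = fun _ => (m : ℤ) from funext h4, val_const hq] at heq
        push_cast at heq
        linarith
  · push Not at h3
    refine false_of_tendsto_val_one hQ hm hq hqQ hqs hqs1 hd (fun n => (hall n).2.2.2.1)
      (fun n => ?_) ?_
    · have h5 := val_nonneg (hall n).2.2.1.1 (hqs1 n)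
      have h6 := (hall n).2.2.2.2
      linarith
    · rw [show c = fun _ => 0 from funext h3, val_zero] at heq
      linarith

/-! ### The lexicographic order -/

/-- The strict lexicographic order on sequences. -/
def LexLT (a b : ℕ → ℤ) : Prop := ∃ k, (∀ i < k, a i = b i) ∧ a k < b k

/-- The lexicographic order on sequences. -/
def LexLE (a b : ℕ → ℤ) : Prop := a = b ∨ LexLT a b

lemma LexLT.le (h : LexLT a b) : LexLE a b := Or.inr h

lemma LexLT.trans (h : LexLT a b) (h' : LexLT b c) : LexLT a c := by
  obtain ⟨k, hk, hlt⟩ := h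
  obtain ⟨k', hk', hlt'⟩ := h'
  rcases lt_trichotomy k k' with h | rfl | h
  · exact ⟨k, fun i hi => (hk i hi).trans (hk' i (hi.trans h)), by rwa [← hk' k h]⟩
  · exact ⟨k, fun i hi => (hk i hi).trans (hk' i hi), hlt.trans hlt'⟩
  · exact ⟨k', fun i hi => (hk i (hi.trans h)).trans (hk' i hi), by rwa [hk k' h]⟩

lemma LexLT.irrefl (a : ℕ → ℤ) : ¬ LexLT a a := fun ⟨_, _, h⟩ => lt_irrefl _ h

lemma lexLT_or_eq_or_lexLT (a b : ℕ → ℤ) : LexLT a b ∨ a = b ∨ LexLT b a := by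
  by_cases h : a = b
  · exact Or.inr (Or.inl h)
  · obtain ⟨k, hk, hd⟩ := exists_first_diff h
    rcases hd.lt_or_gt with h1 | h1
    · exact Or.inl ⟨k, hk, h1⟩
    · exact Or.inr (Or.inr ⟨k, fun i hi => (hk i hi).symm, h1⟩)

lemma LexLE.not_lt (h : LexLE a b) : ¬ LexLT b a := by
  rintro h'
  rcases h with rfl | h
  · exact LexLT.irrefl _ h'
  · exact LexLT.irrefl _ (h.trans h')

lemma LexLE.head_le (h : LexLE a b) : a 0 ≤ b 0 := by
  rcases h with rfl | ⟨k, hk, hlt⟩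
  · exact le_rfl
  · rcases Nat.eq_zero_or_pos k with rfl | h
    · exact hlt.le
    · exact (hk 0 h).le

/-- A sequence squeezed between two sequences shares their common prefix. -/
lemma prefix_eq_of_between {n : ℕ} (hab : LexLE a b) (hbc : LexLT b c) (hac : ∀ i < n, a i = c i) :
    ∀ i < n, b i = c i := by
  rcases hab with rfl | ⟨k, hk, hlt⟩
  · exact hac
  obtain ⟨k', hk', hlt'⟩ := hbc
  by_contra! hc
  obtain ⟨i, hi, hne⟩ := hc
  have h1 : k' ≤ i := not_lt.1 fun h => hne (hk' i h)
  have h2 : k ≤ k' := by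
    by_contra! h
    have h3 := hk k' h
    have h4 := hac k' (by omega)
    omega
  rcases h2.lt_or_eq with h | rfl
  · have h3 := hk' k h
    have h4 := hac k (by omega)
    omega
  · have h4 := hac k (by omega)
    omega

/-- `a` and its reflection dominate all tails of `a` in the lexicographic order. -/
def LexBal (m : ℕ) (a : ℕ → ℤ) : Prop :=
  Dig m a ∧ ∀ n, LexLE (shift n a) a ∧ LexLE (mirror m (shift n a)) a

/-! ### Lexicographic versus numerical comparison -/

lemma val_le_of_lexLT {k : ℕ} (ha : Dig m a) (hb : Dig m b) (hq : 1 < q) (hk : ∀ i < k, b i = a i)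
    (hlt : b k < a k) :
    val q b ≤ val q a + (val q (shift (k + 1) b) - val q (shift (k + 1) a) - 1) / q ^ (k + 1) := by
  have h1 := val_sub_val hb ha hq hk
  have h2 : (b k : ℝ) + 1 ≤ a k := by exact_mod_cast hlt
  have h3 : ((b k - a k : ℝ) + (val q (shift (k + 1) b) - val q (shift (k + 1) a))) / q ^ (k + 1)
      ≤ (val q (shift (k + 1) b) - val q (shift (k + 1) a) - 1) / q ^ (k + 1) := by
    have : 0 < q := by linarith
    gcongr
    linarith
  linarith

/-- If all tails of `b` are lexicographically at most an expansion of `1`, their values are at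
most `1`: each comparison at a first difference divides the possible excess by at least `q`. -/
lemma val_le_one_of_lexLE (ha : Dig m a) (hv : val q a = 1) (hb : Dig m b) (hq : 1 < q)
    (h : ∀ n, LexLE (shift n b) a) : val q b ≤ 1 := by
  have hC : 0 ≤ (m : ℝ) / (q - 1) := div_nonneg (by positivity) (by linarith)
  have key : ∀ j n : ℕ, val q (shift n b) ≤ 1 + (m / (q - 1)) / q ^ j := by
    intro j
    induction j with
    | zero =>
      intro n
      have := val_le (hb.shift n) hq
      simp only [pow_zero, div_one]
      linarith
    | succ j ih =>
      intro n
      rcases h n with h | ⟨k, hk, hlt⟩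
      · rw [h, hv]
        have : 0 ≤ (m : ℝ) / (q - 1) / q ^ (j + 1) := by positivity
        linarith
      · have h1 := val_le_of_lexLT ha (hb.shift n) hq hk hlt
        rw [shift_shift] at h1
        have h2 := ih (n + (k + 1))
        have h3 := val_nonneg (ha.shift (k + 1)) hq
        have h4 : (val q (shift (n + (k + 1)) b) - val q (shift (k + 1) a) - 1) / q ^ (k + 1)
            ≤ (m / (q - 1)) / q ^ j / q ^ (k + 1) := by
          gcongr
          linarith
        have h5 : (m / (q - 1)) / q ^ j / q ^ (k + 1) ≤ (m / (q - 1)) / q ^ (j + 1) := by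
          rw [div_div, ← pow_add]
          gcongr
          · exact hq.le
          · omega
        linarith
  have hlim : Tendsto (fun j : ℕ => 1 + (m / (q - 1)) / q ^ j) atTop (𝓝 (1 + 0)) :=
    tendsto_const_nhds.add (tendsto_const_nhds.div_atTop (tendsto_pow_atTop_atTop_of_one_lt hq))
  rw [add_zero] at hlim
  exact ge_of_tendsto' hlim fun j => by simpa using key j 0

lemma val_lt_one_of_lexLT (ha : Dig m a) (hv : val q a = 1) (hpos : ∀ n, 0 < val q (shift n a))
    (hb : Dig m b) (hq : 1 < q) (hb1 : ∀ n, val q (shift n b) ≤ 1) (h : LexLT b a) :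
    val q b < 1 := by
  obtain ⟨k, hk, hlt⟩ := h
  have h1 := val_le_of_lexLT ha hb hq hk hlt
  have h2 := hb1 (k + 1)
  have h3 := hpos (k + 1)
  have h4 : (val q (shift (k + 1) b) - val q (shift (k + 1) a) - 1) / q ^ (k + 1) < 0 :=
    div_neg_of_neg_of_pos (by linarith) (by positivity)
  linarith

lemma LexBal.bal (h : LexBal m a) (hq : 1 < q) (hv : val q a = 1) : Bal m q a := by
  refine ⟨h.1, fun n => ⟨?_, ?_⟩⟩
  · refine val_le_one_of_lexLE h.1 hv (h.1.shift n) hq fun k => ?_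
    rw [shift_shift]; exact (h.2 _).1
  · refine val_le_one_of_lexLE h.1 hv (h.1.shift n).mirror hq fun k => ?_
    rw [← mirror_shift, shift_shift]; exact (h.2 _).2

lemma Bal.tail_pos (h : Bal m q a) (hq : 1 < q) (hqm : q < m + 1) (n : ℕ) :
    0 < val q (shift n a) ∧ 0 < val q (mirror m (shift n a)) := by
  have h1 : 1 < (m : ℝ) / (q - 1) := by rw [lt_div_iff₀ (by linarith)]; linarith
  have h2 := (h.2 n).1
  have h3 := (h.2 n).2
  rw [val_mirror (h.1.shift n) hq] at h3 ⊢
  constructor <;> linarith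

/-- The numerical and the lexicographic conditions on an expansion of `1` are equivalent. -/
lemma Bal.lexBal (h : Bal m q a) (hq : 1 < q) (hqm : q < m + 1) (hv : val q a = 1) :
    LexBal m a := by
  have key : ∀ b, Dig m b → val q b ≤ 1 → (∀ n, 0 < val q (shift n b)) → LexLE b a := by
    intro b hb hb1 hpos
    rcases lexLT_or_eq_or_lexLT b a with h1 | h1 | ⟨k, hk, hlt⟩
    · exact h1.le
    · exact Or.inl h1
    · exfalso
      have h2 := val_le_of_lexLT hb h.1 hq hk hlt
      have h3 := (h.2 (k + 1)).1
      have h4 : (val q (shift (k + 1) a) - val q (shift (k + 1) b) - 1) / q ^ (k + 1) < 0 :=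
        div_neg_of_neg_of_pos (by have := hpos (k + 1); linarith) (by positivity)
      linarith
  refine ⟨h.1, fun n => ⟨key _ (h.1.shift n) (h.2 n).1 fun k => ?_,
    key _ (h.1.shift n).mirror (h.2 n).2 fun k => ?_⟩⟩
  · rw [shift_shift]; exact (h.tail_pos hq hqm _).1
  · rw [← mirror_shift, shift_shift]; exact (h.tail_pos hq hqm _).2

/-- If the first digit equals its reflection then all digits do. -/
lemma LexBal.head_gt (h : LexBal m a) (hne : mirror m a ≠ a) : m - a 0 < a 0 := by
  have h1 : ∀ n, a n ≤ a 0 ∧ m - a n ≤ a 0 := fun n =>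
    ⟨by simpa using (h.2 n).1.head_le, by simpa using (h.2 n).2.head_le⟩
  by_contra! hc
  refine hne (funext fun n => ?_)
  have h2 := h1 n
  have h3 := (h1 0).2
  simp only [mirror_apply]
  omega

/-! ### Lowering the last digit of a good prefix -/

/-- No suffix of the word `a_0 ⋯ a_{M-1}` is the reflection of a prefix of `a`; the reflected
suffixes are smaller than the prefixes. -/
def Good (m : ℕ) (a : ℕ → ℤ) (M : ℕ) : Prop :=
  ∀ i < M, ∃ k, i + k < M ∧ (∀ j < k, m - a (i + j) = a j) ∧ m - a (i + k) < a k

/-- The word `a_0 ⋯ a_{M-2} (a_{M-1} - 1)`; only the first `M` entries matter. -/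
def lowered (M : ℕ) (a : ℕ → ℤ) : ℕ → ℤ := fun i => if i = M - 1 then a i - 1 else a i

/-- The periodic sequence with period word `lowered M a`. -/
def loweredPeriodic (M : ℕ) (a : ℕ → ℤ) : ℕ → ℤ := fun i => lowered M a (i % M)

/-- `j` copies of the word `lowered M a`, followed by `a`. -/
def loweredPow (M : ℕ) (a : ℕ → ℤ) : ℕ → ℕ → ℤ
  | 0 => a
  | j + 1 => glue M (lowered M a) (loweredPow M a j)

lemma loweredPeriodic_eq_glue (M : ℕ) (a : ℕ → ℤ) :
    loweredPeriodic M a = glue M (lowered M a) (loweredPeriodic M a) := by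
  ext i
  by_cases h : i < M
  · rw [glue_of_lt _ _ h, loweredPeriodic, Nat.mod_eq_of_lt h]
  · obtain ⟨j, rfl⟩ := Nat.exists_eq_add_of_le (not_lt.1 h)
    rw [glue_add, loweredPeriodic, loweredPeriodic, Nat.add_mod_left]

lemma shift_loweredPeriodic (M : ℕ) (a : ℕ → ℤ) :
    shift M (loweredPeriodic M a) = loweredPeriodic M a := by
  conv_lhs => rw [loweredPeriodic_eq_glue]
  exact shift_glue _ _ _

lemma Good.digit_pos {M : ℕ} (hM : 0 < M) (ha : Dig m a) (h : Good m a M) : 0 < a (M - 1) := by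
  obtain ⟨k, hk, -, hlt⟩ := h (M - 1) (by omega)
  obtain rfl : k = 0 := by omega
  have := (ha 0).2
  rw [add_zero] at hlt
  omega

lemma Good.lowered_dig {M : ℕ} (hM : 0 < M) (ha : Dig m a) (h : Good m a M) (i : ℕ) :
    0 ≤ lowered M a i ∧ lowered M a i ≤ m := by
  have h1 := ha i
  have h2 := h.digit_pos hM ha
  by_cases hi : i = M - 1
  · subst hi; simp only [lowered, if_true]; omega
  · simp only [lowered, hi, if_false]; omega

lemma Good.dig_loweredPow {M : ℕ} (hM : 0 < M) (ha : Dig m a) (h : Good m a M) (j : ℕ) :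
    Dig m (loweredPow M a j) := by
  induction j with
  | zero => exact ha
  | succ j ih => exact Dig.glue (fun i _ => h.lowered_dig hM ha i) ih

lemma Good.dig_loweredPeriodic {M : ℕ} (hM : 0 < M) (ha : Dig m a) (h : Good m a M) :
    Dig m (loweredPeriodic M a) := fun _ => h.lowered_dig hM ha _

lemma loweredPow_prefix (M : ℕ) (a : ℕ → ℤ) (j : ℕ) {i : ℕ} (hi : i < M - 1) :
    loweredPow M a j i = a i := by
  cases j with
  | zero => rfl
  | succ j => rw [loweredPow, glue_of_lt _ _ (by omega), lowered, if_neg (by omega)]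

lemma loweredPeriodic_prefix (M : ℕ) (a : ℕ → ℤ) {i : ℕ} (hi : i < M - 1) :
    loweredPeriodic M a i = a i := by
  rw [loweredPeriodic, Nat.mod_eq_of_lt (by omega), lowered, if_neg (by omega)]

/-- After lowering the last digit of a good prefix, the tails starting inside it are strictly
between the reflection of `a` and `a`, provided that the continuation starts like `a`. -/
lemma Good.tail_glue_lt {M : ℕ} (h : Good m a M) (hbal : LexBal m a) (h0 : m - a 0 < a 0)
    (hM1 : M = 1 → m - a 0 < a 0 - 1) {e : ℕ → ℤ} (he : ∀ i < M - 1, e i = a i) {i : ℕ}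
    (hi : i < M) : LexLT (shift i (glue M (lowered M a) e)) a ∧
      LexLT (mirror m (shift i (glue M (lowered M a) e))) a := by
  have hpre : ∀ j, j < M - 1 → glue M (lowered M a) e j = a j := fun j hj => by
    rw [glue_of_lt _ _ (by omega), lowered, if_neg (by omega)]
  have hlast : glue M (lowered M a) e (M - 1) = a (M - 1) - 1 := by
    rw [glue_of_lt _ _ (by omega), lowered, if_pos rfl]
  have hlast' : ∀ {k}, i + k = M - 1 → glue M (lowered M a) e (i + k) = a (i + k) - 1 := by
    intro k hk; rw [hk, hlast]
  constructor
  · have key : (∀ j, i + j < M - 1 → a (i + j) = a j) → a (M - 1) ≤ a (M - 1 - i) →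
        LexLT (shift i (glue M (lowered M a) e)) a := by
      intro h1 h2
      refine ⟨M - 1 - i, fun j hj => ?_, ?_⟩
      · rw [shift_apply, hpre _ (by omega), h1 j (by omega)]
      · rw [shift_apply, show i + (M - 1 - i) = M - 1 by omega, hlast]
        omega
    rcases (hbal.2 i).1 with heq | ⟨k, hk, hlt⟩
    · have h1 : ∀ j, a (i + j) = a j := fun j => congrFun heq j
      refine key (fun j _ => h1 j) (le_of_eq ?_)
      have h2 := h1 (M - 1 - i)
      rwa [show i + (M - 1 - i) = M - 1 by omega] at h2
    · simp only [shift_apply] at hk hlt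
      rcases lt_trichotomy (i + k) (M - 1) with h1 | h1 | h1
      · refine ⟨k, fun j hj => ?_, ?_⟩
        · rw [shift_apply, hpre _ (by omega), hk j hj]
        · rwa [shift_apply, hpre _ h1]
      · refine key (fun j hj => hk j (by omega)) ?_
        rw [← h1, show i + k - i = k by omega]
        exact hlt.le
      · refine key (fun j hj => hk j (by omega)) ?_
        have := hk (M - 1 - i) (by omega)
        rw [show i + (M - 1 - i) = M - 1 by omega] at this
        exact this.le
  · obtain ⟨k, hkM, hk, hlt⟩ := h i hi
    have hpre' : ∀ j < k, m - glue M (lowered M a) e (i + j) = a j := fun j hj => by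
      rw [hpre _ (by omega), hk j hj]
    rcases Nat.lt_or_ge (i + k) (M - 1) with h1 | h1
    · refine ⟨k, fun j hj => ?_, ?_⟩
      · rw [mirror_apply, shift_apply, hpre' j hj]
      · rwa [mirror_apply, shift_apply, hpre _ h1]
    · have h2 : i + k = M - 1 := by omega
      have h3 := hlast' h2
      by_cases h4 : m - (a (i + k) - 1) < a k
      · refine ⟨k, fun j hj => ?_, ?_⟩
        · rw [mirror_apply, shift_apply, hpre' j hj]
        · rwa [mirror_apply, shift_apply, h3]
      · -- equality up to the lowered digit; the comparison is decided inside the continuation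
        have h5 : m - (a (i + k) - 1) = a k := by omega
        have hi0 : 0 < i := by
          by_contra hi0
          obtain rfl : i = 0 := by omega
          rcases Nat.eq_zero_or_pos k with rfl | hk0
          · have := hM1 (by omega)
            simp only [add_zero] at h5
            omega
          · have := hk 0 hk0
            simp only [add_zero] at this
            omega
        obtain ⟨k', hk'M, hk', hlt'⟩ := h (M - i) (by omega)
        have hcont : ∀ t, t ≤ k' → glue M (lowered M a) e (i + (M - i + t)) = a t := by
          intro t ht
          rw [show i + (M - i + t) = M + t by omega, glue_add, he t (by omega)]
        refine ⟨M - i + k', fun j hj => ?_, ?_⟩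
        · rw [mirror_apply, shift_apply]
          rcases lt_trichotomy j k with hjk | rfl | hjk
          · exact hpre' j hjk
          · rw [h3, h5]
          · obtain ⟨t, rfl⟩ := Nat.exists_eq_add_of_le (show M - i ≤ j by omega)
            rw [hcont t (by omega)]
            have := hk' t (by omega)
            omega
        · rw [mirror_apply, shift_apply, hcont k' le_rfl]
          omega

lemma Good.loweredPow_lexLE {M : ℕ} (h : Good m a M) (hbal : LexBal m a)
    (h0 : m - a 0 < a 0) (hM1 : M = 1 → m - a 0 < a 0 - 1) (j n : ℕ) :
    LexLE (shift n (loweredPow M a j)) a ∧ LexLE (mirror m (shift n (loweredPow M a j))) a := by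
  induction j generalizing n with
  | zero => exact hbal.2 n
  | succ j ih =>
    rcases Nat.lt_or_ge n M with hn | hn
    · have := h.tail_glue_lt hbal h0 hM1 (fun i hi => loweredPow_prefix M a j hi) hn
      exact ⟨this.1.le, this.2.le⟩
    · obtain ⟨t, rfl⟩ := Nat.exists_eq_add_of_le hn
      rw [← shift_shift, loweredPow, shift_glue]
      exact ih t

lemma Good.loweredPeriodic_lexLT {M : ℕ} (h : Good m a M) (hM : 0 < M) (hbal : LexBal m a)
    (h0 : m - a 0 < a 0) (hM1 : M = 1 → m - a 0 < a 0 - 1) (n : ℕ) :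
    LexLT (shift n (loweredPeriodic M a)) a ∧
      LexLT (mirror m (shift n (loweredPeriodic M a))) a := by
  induction n using Nat.strong_induction_on with
  | _ n ih =>
    rcases Nat.lt_or_ge n M with hn | hn
    · rw [loweredPeriodic_eq_glue]
      exact h.tail_glue_lt hbal h0 hM1 (fun i hi => loweredPeriodic_prefix M a hi) hn
    · obtain ⟨t, rfl⟩ := Nat.exists_eq_add_of_le hn
      rw [← shift_shift, shift_loweredPeriodic]
      exact ih t (by omega)

/-! ### Raising the last digit of the period -/

/-- The word `a_0 ⋯ a_{n-2} (a_{n-1} + 1)`; only the first `n` entries matter. -/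
def raised (n : ℕ) (a : ℕ → ℤ) : ℕ → ℤ := fun i => if i = n - 1 then a i + 1 else a i

/-- The matching condition under which the raised period can be followed by a sequence starting
like the reflection of `a`: whenever a suffix of length `l` of the raised period is a prefix of
`a`, the reflection of `a` is smaller than the tail of `a` at `l`, and this is visible in the first
`M - 1` digits. -/
def Matching (m n M : ℕ) (a : ℕ → ℤ) : Prop :=
  ∀ l, 0 < l → l < n → (∀ j < l - 1, a (n - l + j) = a j) → a (n - 1) + 1 = a (l - 1) →
    ∃ k < M - 1, (∀ j < k, m - a j = a (l + j)) ∧ m - a k < a (l + k)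

lemma tail_glue_raised_lt {n M : ℕ} (hbal : LexBal m a) (hper : shift n a = a)
    (hmin : ∀ l, 0 < l → l < n → shift l a ≠ a) (hmatch : Matching m n M a) {e : ℕ → ℤ}
    (he : ∀ i < M - 1, e i = m - a i) {i : ℕ} (hi0 : 0 < i) (hi : i < n) :
    LexLT (shift i (glue n (raised n a) e)) a ∧
      LexLT (mirror m (shift i (glue n (raised n a) e))) a := by
  have hpre : ∀ j, i + j < n - 1 → glue n (raised n a) e (i + j) = a (i + j) := fun j hj => by
    rw [glue_of_lt _ _ (by omega), raised, if_neg (by omega)]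
  have hlast : ∀ j, i + j = n - 1 → glue n (raised n a) e (i + j) = a (i + j) + 1 := fun j hj => by
    rw [glue_of_lt _ _ (by omega), raised, if_pos hj]
  constructor
  · -- the suffix at `i` cannot be a prefix of `a`, as `n` is the smallest period
    have hdiff : ∃ k, i + k < n ∧ (∀ j < k, a (i + j) = a j) ∧ a (i + k) < a k := by
      rcases (hbal.2 i).1 with heq | ⟨k, hk, hlt⟩
      · exact absurd heq (hmin i hi0 hi)
      · refine ⟨k, ?_, hk, hlt⟩
        by_contra! hkn
        simp only [shift_apply] at hk hlt
        have hper' : ∀ j, a (n + j) = a j := fun j => congrFun hper j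
        obtain ⟨t, rfl⟩ := Nat.exists_eq_add_of_le (show n - i ≤ k by omega)
        -- equality on the whole suffix makes the tail at `n - i` larger than `a`
        refine (hbal.2 (n - i)).1.not_lt ⟨t, fun j hj => ?_, ?_⟩
        · have := hk (n - i + j) (by omega)
          rw [show i + (n - i + j) = n + j by omega, hper'] at this
          simpa using this
        · rw [show i + (n - i + t) = n + t by omega, hper'] at hlt
          simpa using hlt
    obtain ⟨k, hkn, hk, hlt⟩ := hdiff
    rcases Nat.lt_or_ge (i + k) (n - 1) with h1 | h1
    · refine ⟨k, fun j hj => ?_, ?_⟩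
      · rw [shift_apply, hpre _ (by omega), hk j hj]
      · rwa [shift_apply, hpre _ h1]
    · have h2 : i + k = n - 1 := by omega
      rcases (show a (i + k) + 1 ≤ a k by omega).lt_or_eq with h3 | h3
      · refine ⟨k, fun j hj => ?_, ?_⟩
        · rw [shift_apply, hpre _ (by omega), hk j hj]
        · rwa [shift_apply, hlast _ h2]
      · obtain ⟨s, hsM, hs, hslt⟩ := hmatch (k + 1) (by omega) (by omega)
          (fun j hj => by rw [show n - (k + 1) + j = i + j by omega]; exact hk j (by omega))
          (by rw [← h2, h3]; simp)
        have hcont : ∀ t ≤ s, glue n (raised n a) e (i + (k + 1 + t)) = m - a t := by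
          intro t ht
          rw [show i + (k + 1 + t) = n + t by omega, glue_add, he t (by omega)]
        refine ⟨k + 1 + s, fun j hj => ?_, ?_⟩
        · rw [shift_apply]
          rcases lt_trichotomy j k with hjk | rfl | hjk
          · rw [hpre _ (by omega), hk j hjk]
          · rw [hlast _ h2, h3]
          · obtain ⟨t, rfl⟩ := Nat.exists_eq_add_of_le (show k + 1 ≤ j by omega)
            rw [hcont t (by omega), hs t (by omega)]
        · rw [shift_apply, hcont s le_rfl]
          exact hslt
  · have key : (∀ j, i + j < n - 1 → m - a (i + j) = a j) → m - a (n - 1) ≤ a (n - 1 - i) →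
        LexLT (mirror m (shift i (glue n (raised n a) e))) a := by
      intro h1 h2
      refine ⟨n - 1 - i, fun j hj => ?_, ?_⟩
      · rw [mirror_apply, shift_apply, hpre _ (by omega), h1 j (by omega)]
      · rw [mirror_apply, shift_apply, hlast _ (by omega), show i + (n - 1 - i) = n - 1 by omega]
        omega
    rcases (hbal.2 i).2 with heq | ⟨k, hk, hlt⟩
    · have h1 : ∀ j, m - a (i + j) = a j := fun j => congrFun heq j
      refine key (fun j _ => h1 j) (le_of_eq ?_)
      have h2 := h1 (n - 1 - i)
      rwa [show i + (n - 1 - i) = n - 1 by omega] at h2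
    · simp only [mirror_apply, shift_apply] at hk hlt
      rcases lt_trichotomy (i + k) (n - 1) with h1 | h1 | h1
      · refine ⟨k, fun j hj => ?_, ?_⟩
        · rw [mirror_apply, shift_apply, hpre _ (by omega), hk j hj]
        · rwa [mirror_apply, shift_apply, hpre _ h1]
      · refine key (fun j hj => hk j (by omega)) ?_
        rw [← h1, show i + k - i = k by omega]
        exact hlt.le
      · refine key (fun j hj => hk j (by omega)) ?_
        have := hk (n - 1 - i) (by omega)
        rw [show i + (n - 1 - i) = n - 1 by omega] at this
        exact this.le

/-! ### Accumulating bases in `B₂` -/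

lemma val_lt_one_of_lt (ha : Dig m a) (hq : 1 < q) (hqq : q < q') (h : val q a ≤ 1) :
    val q' a < 1 := by
  rcases (val_nonneg ha hq).eq_or_lt with h0 | h0
  · have := val_anti ha hq hqq.le
    linarith
  · exact (val_strictAnti ha hq hqq h0).trans_le h

lemma exists_ne_zero_of_val_pos (h : 0 < val q a) : ∃ i, a i ≠ 0 := by
  by_contra! hc
  simp [show a = fun _ => 0 from funext hc] at h

lemma Uni.of_tails (ha : Dig m a)
    (h : ∀ n, val q (TwoExpansions.shift (n + 1) a) < 1 ∧
      val q (TwoExpansions.mirror m (TwoExpansions.shift (n + 1) a)) < 1) : Uni m q a :=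
  ⟨ha, fun n => ⟨fun _ => (h n).1, fun _ => (h n).2⟩⟩

/-- Leading zeros may be put in front of a unique expansion of a number smaller than `1`. -/
lemma Uni.glue_zero (h : Uni m q a) (hq : 1 < q) (hv : val q a < 1) (n : ℕ) :
    Uni m q (glue n (fun _ => 0) a) := by
  have hd : ∀ n, Dig m (glue n (fun _ => 0) a) := fun n =>
    Dig.glue (fun _ _ => ⟨le_rfl, by positivity⟩) h.1
  have hle : ∀ n, val q (glue n (fun _ => 0) a) < 1 := by
    intro n
    rw [val_glue (hd n) hq]
    have h0 := val_nonneg h.1 hq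
    have h1 : (1 : ℝ) ≤ q ^ n := one_le_pow₀ hq.le
    have h2 : val q a / q ^ n ≤ val q a := div_le_self h0 h1
    simp
    linarith
  refine ⟨hd n, fun i => ?_⟩
  rcases Nat.lt_or_ge i n with hi | hi
  · have h1 : TwoExpansions.shift (i + 1) (glue n (fun _ => 0) a)
        = glue (n - (i + 1)) (fun _ => 0) a := by
      ext j
      simp only [shift_apply, glue]
      split_ifs
      · rfl
      · omega
      · omega
      · congr 1; omega
    have h2 : glue n (fun _ => 0) a i = 0 := glue_of_lt _ _ hi
    rw [h1, h2]
    exact ⟨fun _ => hle _, fun h => absurd h (lt_irrefl _)⟩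
  · obtain ⟨t, rfl⟩ := Nat.exists_eq_add_of_le hi
    rw [glue_add, add_assoc, ← shift_shift,
      shift_glue]
    exact h.2 t

/-- Let the word `w` of length `n` have value `1` in base `q`, and let the sequences `e j` have
increasing values and be such that `w (e j)` and `0^n (e j)` are unique expansions in all bases
`p > q`. For `j < l` the equation `1 + val p (0^n (e j)) = val p (w (e l))` then has a solution
`p > q` in `B₂`, close to `q` if `j` and `l` are large. Letting first `l → ∞` and then `j → ∞`
yields `q ∈ B₂⁽²⁾`. -/
lemma mem_iterTwoBases_two {n : ℕ} {w : ℕ → ℤ} {e : ℕ → ℕ → ℤ} (hq : 1 < q) (hqm : q < m + 1)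
    (hbig : m < 2 * (q - 1)) (hw : val q (glue n w fun _ => 0) = 1)
    (hu : ∀ p, q < p → p < m + 1 → ∀ j, Uni m p (e j) ∧ Uni m p (glue n w (e j)) ∧
      Uni m p (glue n (fun _ => 0) (e j)))
    (hmono : ∀ p, q ≤ p → StrictMono fun j => val p (e j)) : q ∈ iterTwoBases m 2 := by
  obtain ⟨p₀, hp₀, hp₀m⟩ := exists_between hqm
  have hed : ∀ j, Dig m (e j) := fun j => (hu p₀ hp₀ hp₀m j).1.1
  have hwed : ∀ j, Dig m (glue n w (e j)) := fun j => (hu p₀ hp₀ hp₀m j).2.1.1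
  have hzed : ∀ j, Dig m (glue n (fun _ => 0) (e j)) := fun j => (hu p₀ hp₀ hp₀m j).2.2.1
  have hwd : Dig m (glue n w fun _ => 0) := Dig.glue (fun i hi => by
    have := hwed 0 i
    rwa [glue_of_lt _ _ hi] at this) fun _ => ⟨le_rfl, by positivity⟩
  -- the difference of the two sides of the equation
  let F : ℕ → ℕ → ℝ → ℝ := fun j l p =>
    val p (glue n w (e l)) - val p (glue n (fun _ => 0) (e j)) - 1
  have hF : ∀ j l p, 1 < p → F j l p =
      (val p (glue n w fun _ => 0) - 1) + (val p (e l) - val p (e j)) / p ^ n := by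
    intro j l p hp
    simp only [F]
    rw [val_glue (hwed l) hp, val_glue (hzed j) hp, val_glue hwd hp, val_zero]
    simp
    ring
  have hFc : ∀ j l p, 1 < p → ContinuousAt (F j l) p := fun j l p hp =>
    ((continuousAt_val (hwed l) hp).sub (continuousAt_val (hzed j) hp)).sub continuousAt_const
  have hFq : ∀ j l, j < l → 0 < F j l q := by
    intro j l hjl
    rw [hF j l q hq, hw, sub_self, zero_add]
    have := hmono q le_rfl hjl
    exact div_pos (sub_pos.2 this) (by positivity)
  have hmem : ∀ p, q < p → p < m + 1 → ∀ j l, F j l p = 0 → p ∈ twoBases m := by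
    intro p hp hpm j l h
    refine mem_twoBases (hq.trans hp) hpm.le (by linarith) (hu p hp hpm j).2.2 (hu p hp hpm l).2.1 ?_
    simp only [F] at h
    linarith
  have hinj : ∀ p, q < p → p < m + 1 → ∀ j l l', F j l p = 0 → F j l' p = 0 → l = l' := by
    intro p hp hpm j l l' h h'
    rw [hF _ _ _ (hq.trans hp)] at h h'
    have h1 : (val p (e l) - val p (e j)) / p ^ n = (val p (e l') - val p (e j)) / p ^ n := by
      linarith
    have h2 : p ^ n ≠ 0 := (pow_pos (by linarith) n).ne'
    rw [div_left_inj' h2] at h1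
    exact (hmono p hp.le).injective (by simpa using h1)
  -- solutions in `(q, r)` for all large `j < l`
  have hsol : ∀ r, q < r → r < m + 1 → ∃ J, ∀ l, J < l → ∃ p, q < p ∧ p < r ∧ F J l p = 0 := by
    intro r hr hrm
    have hr1 : 1 < r := hq.trans hr
    have hη : val r (glue n w fun _ => 0) < 1 := hw ▸ val_strictAnti hwd hq hr (by linarith)
    have hconv : Tendsto (fun j => val r (e j)) atTop (𝓝 (⨆ j, val r (e j))) :=
      tendsto_atTop_ciSup (hmono r hr.le).monotone
        ⟨m / (r - 1), by rintro _ ⟨j, rfl⟩; exact val_le (hed j) hr1⟩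
    obtain ⟨J, hJ⟩ := (hconv.eventually (lt_mem_nhds (sub_lt_self _ (sub_pos.2 hη)))).exists
    refine ⟨J, fun l hl => ?_⟩
    have hsup : val r (e l) ≤ ⨆ j, val r (e j) :=
      le_ciSup (f := fun j => val r (e j))
        ⟨m / (r - 1), by rintro _ ⟨j, rfl⟩; exact val_le (hed j) hr1⟩ l
    have hFr : F J l r < 0 := by
      rw [hF J l r hr1]
      have h1 : (val r (e l) - val r (e J)) / r ^ n ≤ val r (e l) - val r (e J) :=
        div_le_self (sub_nonneg.2 ((hmono r hr.le).monotone hl.le)) (one_le_pow₀ hr1.le)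
      linarith
    have hcont : ContinuousOn (F J l) (Icc q r) := fun p hp =>
      (hFc J l p (hq.trans_le hp.1)).continuousWithinAt
    obtain ⟨p, hp, hp0⟩ := intermediate_value_Ioo' hr.le hcont ⟨hFr, hFq J l hl⟩
    exact ⟨p, hp.1, hp.2, hp0⟩
  have hacc : ∀ r, q < r → r < m + 1 → ∃ p ∈ iterTwoBases m 1, q < p ∧ p ≤ r := by
    intro r hr hrm
    obtain ⟨J, hJ⟩ := hsol r hr hrm
    choose! p hp1 hp2 hp3 using hJ
    have hinf : (p '' Ioi J).Infinite := by
      refine (Ioi_infinite J).image fun l hl l' hl' hll => ?_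
      exact hinj (p l) (hp1 l hl) ((hp2 l hl).trans hrm) J l l' (hp3 l hl) (hll ▸ hp3 l' hl')
    have hsub : p '' Ioi J ⊆ Icc q r := by
      rintro _ ⟨l, hl, rfl⟩
      exact ⟨(hp1 l hl).le, (hp2 l hl).le⟩
    obtain ⟨x, hx, hxacc⟩ := hinf.exists_accPt_of_subset_isCompact isCompact_Icc hsub
    refine ⟨x, ⟨⟨hq.trans_le hx.1, hx.2.trans hrm.le⟩, ?_⟩, ?_, hx.2⟩
    · refine hxacc.mono (principal_mono.2 ?_)
      rintro _ ⟨l, hl, rfl⟩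
      exact hmem _ (hp1 l hl) ((hp2 l hl).trans hrm) J l (hp3 l hl)
    · refine lt_of_le_of_ne hx.1 ?_
      rintro rfl
      -- near `q` the function for `J, J + 1` is a positive lower bound of those for `J, l`
      have hpos := (hFc J (J + 1) q hq).eventually (lt_mem_nhds (hFq J (J + 1) (by omega)))
      obtain ⟨_, hy, -, ⟨l, hl, rfl⟩⟩ := ((accPt_iff_frequently.1 hxacc).and_eventually hpos).exists.imp
        fun y hy => (⟨hy.2, hy.1.1, hy.1.2⟩ : 0 < F J (J + 1) y ∧ y ≠ q ∧ y ∈ p '' Ioi J)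
      have h1 : 1 < p l := hq.trans (hp1 l hl)
      have h2 := hp3 l hl
      rw [hF _ _ _ h1] at hy h2
      have h3 := (hmono (p l) (hp1 l hl).le).monotone (Nat.succ_le_of_lt hl)
      have h4 : (val (p l) (e (J + 1)) - val (p l) (e J)) / p l ^ n ≤
          (val (p l) (e l) - val (p l) (e J)) / p l ^ n := by
        have : 0 < p l := by linarith
        gcongr
      linarith
  refine ⟨⟨hq, hqm.le⟩, accPt_iff_frequently.2 (frequently_nhds_iff.2 fun U hU hUo => ?_)⟩
  obtain ⟨ε, hε, hball⟩ := Metric.isOpen_iff.1 hUo q hU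
  obtain ⟨x, hx, hx1, hx2⟩ := hacc (min (q + ε / 2) ((q + (m + 1)) / 2))
    (lt_min (by linarith) (by linarith)) ((min_le_right _ _).trans_lt (by linarith))
  refine ⟨x, hball ?_, hx1.ne', hx⟩
  rw [Metric.mem_ball, Real.dist_eq, abs_of_pos (by linarith)]
  have := hx2.trans (min_le_left _ _)
  linarith

/-- A periodic lexicographically balanced expansion of `1` with smallest period `n`, together with a
good prefix of length `M`, places the base in `B₂` and in `B₂⁽²⁾`: with `w` the raised period,
the reflections of the sequences `loweredPow M a j` serve as the tails `e j`, and the reflection of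
`loweredPeriodic M a` as a common tail in base `q` itself. -/
lemma mem_twoBases_and_iter_of_lexBal {n M : ℕ} (hq : 1 < q) (hqm : q < m + 1) (hbal : LexBal m a)
    (hv : val q a = 1) (hne : mirror m a ≠ a) (hn : 0 < n) (hper : shift n a = a)
    (hmin : ∀ l, 0 < l → l < n → shift l a ≠ a) (hM : 0 < M) (hgood : Good m a M)
    (hM1 : M = 1 → m - a 0 < a 0 - 1) (hmatch : Matching m n M a) :
    q ∈ twoBases m ∧ q ∈ iterTwoBases m 2 := by
  have h0 := hbal.head_gt hne
  have hB := hbal.bal hq hv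
  have hpos : ∀ n, 0 < val q (shift n a) := fun n => (hB.tail_pos hq hqm n).1
  have hbig : m < 2 * (q - 1) := by
    have h1 : LexLT (mirror m a) a := ⟨0, fun _ h => absurd h (Nat.not_lt_zero _), h0⟩
    have h2 := val_lt_one_of_lexLT hbal.1 hv hpos hbal.1.mirror hq
      (fun n => by rw [← mirror_shift]; exact (hB.2 n).2) h1
    rw [val_mirror hbal.1 hq, hv] at h2
    have h3 : (m : ℝ) / (q - 1) < 2 := by linarith
    rwa [div_lt_iff₀ (by linarith)] at h3
  have hlast : a (n - 1) < m := by
    refine lt_of_le_of_ne (hbal.1 _).2 fun h => ?_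
    have h1 := val_shift hbal.1 hq (n - 1)
    rw [Nat.sub_add_cancel hn, hper, hv, h] at h1
    have h2 := (hB.2 (n - 1)).1
    push_cast at h1
    nlinarith
  have hwd : ∀ i < n, 0 ≤ raised n a i ∧ raised n a i ≤ m := by
    intro i _
    have := hbal.1 i
    by_cases hi : i = n - 1
    · subst hi; simp only [raised, if_true]; omega
    · simp only [raised, hi, if_false]; omega
  have hz : Dig m fun _ => 0 := fun _ => ⟨le_rfl, by positivity⟩
  have hw : val q (glue n (raised n a) fun _ => 0) = 1 := by
    have h1 := val_sub_val (Dig.glue hwd hz) hbal.1 hq (k := n - 1) fun i hi => by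
      rw [glue_of_lt _ _ (by omega), raised, if_neg (by omega)]
    rw [Nat.sub_add_cancel hn, shift_glue, hper, hv, glue_of_lt _ _ (by omega), raised, if_pos rfl,
      val_zero] at h1
    push_cast at h1
    rw [show (a (n - 1) + 1 - a (n - 1) + (0 - 1) : ℝ) = 0 by ring, zero_div] at h1
    linarith
  -- unique expansions with a given reflected tail `e`
  have hglue : ∀ (p : ℝ) (e : ℕ → ℤ), 1 < p → Dig m e → (∀ i < M - 1, e i = a i) →
      (∀ n, val p (shift n e) < 1 ∧ val p (mirror m (shift n e)) < 1) →
      (∀ b, Dig m b → (∀ k, val q (shift k b) ≤ 1) → LexLT b a → val p b < 1) →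
      (∀ n, LexLE (shift n e) a ∧ LexLE (mirror m (shift n e)) a) →
      Uni m p (mirror m e) ∧ Uni m p (glue n (raised n a) (mirror m e)) ∧
        Uni m p (glue n (fun _ => 0) (mirror m e)) := by
    intro p e hp hed hpre htail hlt hlex
    have htail' : ∀ n, val p (shift n (mirror m e)) < 1 ∧
        val p (mirror m (shift n (mirror m e))) < 1 := fun n => by
      rw [← mirror_shift, mirror_mirror]; exact (htail n).symm
    have hu : Uni m p (mirror m e) := Uni.of_tails hed.mirror fun n => htail' (n + 1)
    have hd : Dig m (glue n (raised n a) (mirror m e)) := Dig.glue hwd hed.mirror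
    refine ⟨hu, Uni.of_tails hd fun i => ?_, hu.glue_zero hp (by simpa using (htail' 0).1) n⟩
    have hfar : ∀ t, shift (n + t) (glue n (raised n a) (mirror m e)) = shift t (mirror m e) := by
      intro t
      rw [← shift_shift, shift_glue]
    rcases Nat.lt_or_ge (i + 1) n with hi | hi
    · have hin : ∀ k, 0 < k → LexLE (shift k (glue n (raised n a) (mirror m e))) a ∧
          LexLE (mirror m (shift k (glue n (raised n a) (mirror m e)))) a := by
        intro k hk
        rcases Nat.lt_or_ge k n with hkn | hkn
        · have := tail_glue_raised_lt hbal hper hmin hmatch (e := mirror m e)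
            (fun i hi => by rw [mirror_apply, hpre i hi]) hk hkn
          exact ⟨this.1.le, this.2.le⟩
        · obtain ⟨t, rfl⟩ := Nat.exists_eq_add_of_le hkn
          rw [hfar, ← mirror_shift, mirror_mirror]
          exact (hlex t).symm
      have hstrict := tail_glue_raised_lt hbal hper hmin hmatch (e := mirror m e)
            (fun i hi => by rw [mirror_apply, hpre i hi]) (Nat.succ_pos i) hi
      refine ⟨hlt _ (hd.shift _) (fun k => ?_) hstrict.1,
        hlt _ (hd.shift _).mirror (fun k => ?_) hstrict.2⟩
      · refine val_le_one_of_lexLE hbal.1 hv ((hd.shift _).shift _) hq fun j => ?_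
        rw [shift_shift, shift_shift]
        exact (hin _ (by omega)).1
      · refine val_le_one_of_lexLE hbal.1 hv ((hd.shift _).mirror.shift _) hq fun j => ?_
        rw [shift_shift, ← mirror_shift, shift_shift]
        exact (hin _ (by omega)).2
    · obtain ⟨t, ht⟩ := Nat.exists_eq_add_of_le hi
      rw [ht, hfar]
      exact htail' t
  have hltq : ∀ b, Dig m b → (∀ k, val q (shift k b) ≤ 1) → LexLT b a → val q b < 1 :=
    fun b hb hb1 hlt => val_lt_one_of_lexLT hbal.1 hv hpos hb hq hb1 hlt
  have hlexq : ∀ e, Dig m e → (∀ n, LexLE (shift n e) a ∧ LexLE (mirror m (shift n e)) a) →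
      ∀ n, val q (shift n e) ≤ 1 ∧ val q (mirror m (shift n e)) ≤ 1 := by
    intro e he hle n
    refine ⟨val_le_one_of_lexLE hbal.1 hv (he.shift n) hq fun k => ?_,
      val_le_one_of_lexLE hbal.1 hv (he.shift n).mirror hq fun k => ?_⟩
    · rw [shift_shift]; exact (hle _).1
    · rw [← mirror_shift, shift_shift]; exact (hle _).2
  constructor
  · have hd := hgood.dig_loweredPeriodic hM hbal.1
    have hlt := hgood.loweredPeriodic_lexLT hM hbal h0 hM1
    have hle := fun n => (⟨(hlt n).1.le, (hlt n).2.le⟩ : LexLE _ _ ∧ LexLE _ _)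
    have hq1 := hlexq _ hd hle
    obtain ⟨-, h1, h2⟩ := hglue q (loweredPeriodic M a) hq hd
      (fun i hi => loweredPeriodic_prefix M a hi) (fun n =>
        ⟨hltq _ (hd.shift n) (fun k => by rw [shift_shift]; exact (hq1 _).1) (hlt n).1,
          hltq _ (hd.shift n).mirror
            (fun k => by rw [← mirror_shift, shift_shift]; exact (hq1 _).2) (hlt n).2⟩)
      hltq hle
    refine mem_twoBases hq hqm.le hbig h2 h1 ?_
    rw [val_glue h1.1 hq, val_glue h2.1 hq, ← hw, val_glue (Dig.glue hwd hz) hq, val_zero]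
    simp
  · have hd := hgood.dig_loweredPow hM hbal.1
    have hle := hgood.loweredPow_lexLE hbal h0 hM1
    refine mem_iterTwoBases_two (n := n) (w := raised n a)
      (e := fun j => mirror m (loweredPow M a j)) hq hqm hbig hw (fun p hp hpm j => ?_)
      fun p hp => ?_
    · have hq1 := hlexq _ (hd j) (hle j)
      exact hglue p (loweredPow M a j) (hq.trans hp) (hd j)
        (fun i hi => loweredPow_prefix M a j hi)
        (fun n => ⟨val_lt_one_of_lt ((hd j).shift n) hq hp (hq1 n).1,
          val_lt_one_of_lt ((hd j).shift n).mirror hq hp (hq1 n).2⟩)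
        (fun b hb hb1 hlt => val_lt_one_of_lt hb hq hp (by simpa using hb1 0)) (hle j)
    · have hp1 : 1 < p := hq.trans_le hp
      have key : ∀ j, val p (loweredPow M a (j + 1)) < val p (loweredPow M a j) := by
        intro j
        induction j with
        | zero =>
          have h1 := val_sub_val (hd 1) (hd 0) hp1 (k := M - 1)
            (fun i hi => by rw [loweredPow_prefix M a 1 hi, loweredPow_prefix M a 0 hi])
          rw [Nat.sub_add_cancel hM] at h1
          have h2 : loweredPow M a 1 (M - 1) = a (M - 1) - 1 := by
            rw [loweredPow, glue_of_lt _ _ (by omega), lowered, if_pos rfl]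
          have h3 : shift M (loweredPow M a 1) = a := shift_glue _ _ _
          rw [h2, h3] at h1
          simp only [loweredPow] at h1
          push_cast at h1
          have h4 : val p a ≤ 1 := hv ▸ val_anti hbal.1 hq hp
          obtain ⟨i, hi⟩ := exists_ne_zero_of_val_pos (hpos M)
          have h5 := val_pos (hbal.1.shift M) hp1 hi
          have h6 : ((a (M - 1) - 1 - a (M - 1) : ℝ) + (val p a - val p (shift M a))) / p ^ M < 0 :=
            div_neg_of_neg_of_pos (by linarith) (by positivity)
          simp only [loweredPow]
          linarith
        | succ j ih =>
          have h1 := val_glue (hd (j + 1 + 1)) hp1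
          have h2 := val_glue (hd (j + 1)) hp1
          have h3 : val p (loweredPow M a (j + 1)) / p ^ M < val p (loweredPow M a j) / p ^ M := by
            gcongr
          simp only [loweredPow] at h1 h2 h3 ⊢
          linarith
      refine strictMono_nat_of_lt_succ fun j => ?_
      rw [val_mirror (hd j) hp1, val_mirror (hd (j + 1)) hp1]
      have := key j
      linarith

/-! ### Existence of good prefixes -/

/-- If all reflected tails of `a` are strictly smaller than `a`, then `a` has arbitrarily long good
prefixes. If the prefix of length `N` is not good, take its longest suffix that is a reflected
prefix and extend the prefix until this suffix stops being one. -/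
lemma exists_good (hbal : LexBal m a) (hlt : ∀ i, LexLT (mirror m (shift i a)) a) (N : ℕ) :
    ∃ M, N < M ∧ Good m a M := by
  classical
  choose K hK hKlt using hlt
  simp only [mirror_apply, shift_apply] at hK hKlt
  by_cases hN : ∃ i, i < N + 1 ∧ N + 1 ≤ i + K i
  · set i := Nat.find hN
    obtain ⟨hi1, hi2⟩ : i < N + 1 ∧ N + 1 ≤ i + K i := Nat.find_spec hN
    have hmin : ∀ j < i, j + K j < N + 1 := fun j hj => by
      have := Nat.find_min hN hj
      omega
    refine ⟨i + K i + 1, by omega, fun j hj => ⟨K j, ?_, hK j, hKlt j⟩⟩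
    rcases lt_trichotomy j i with h | h | h
    · have := hmin j h
      omega
    · rw [h]; omega
    · by_contra! hc
      obtain ⟨l, rfl⟩ := Nat.exists_eq_add_of_le h.le
      -- otherwise the tail of `a` at `l` would exceed `a`
      refine (hbal.2 l).1.not_lt ⟨K i - l, fun t ht => ?_, ?_⟩
      · have h1 := hK i (l + t) (by omega)
        have h2 := hK (i + l) t (by omega)
        rw [show i + (l + t) = i + l + t by ring] at h1
        rw [shift_apply, ← h1, h2]
      · have h1 := hKlt i
        have h2 := hK (i + l) (K i - l) (by omega)
        rw [show i + l + (K i - l) = i + K i by omega] at h2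
        rw [shift_apply, ← h2, show l + (K i - l) = K i by omega]
        exact h1
  · push Not at hN
    exact ⟨N + 1, by omega, fun i hi => ⟨K i, hN i hi, hK i, hKlt i⟩⟩

lemma good_of_shift_eq_mirror (hbal : LexBal m a) (h0 : m - a 0 < a 0) {r : ℕ}
    (hr : shift r a = mirror m a) (hmin : ∀ i, 0 < i → i < r → shift i a ≠ mirror m a) :
    Good m a r := by
  intro i hi
  rcases Nat.eq_zero_or_pos i with rfl | hi0
  · exact ⟨0, hi, fun _ h => absurd h (Nat.not_lt_zero _), by simpa using h0⟩
  · rcases (hbal.2 i).2 with heq | ⟨k, hk, hlt⟩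
    · exact absurd (by rw [← mirror_mirror (m := m) (shift i a), heq]) (hmin i hi0 hi)
    · simp only [mirror_apply, shift_apply] at hk hlt
      refine ⟨k, ?_, hk, hlt⟩
      by_contra! hc
      have hr' : ∀ t, a (r + t) = m - a t := fun t => congrFun hr t
      obtain ⟨t, rfl⟩ := Nat.exists_eq_add_of_le (show r - i ≤ k by omega)
      refine (hbal.2 (r - i)).1.not_lt ⟨t, fun j hj => ?_, ?_⟩
      · have := hk (r - i + j) (by omega)
        rw [show i + (r - i + j) = r + j by omega, hr'] at this
        rw [shift_apply]; omega
      · rw [show i + (r - i + t) = r + t by omega, hr'] at hlt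
        rw [shift_apply]; omega

/-! ### Periodic expansions of `1` -/

lemma shift_eq_of_period {n : ℕ} (h : shift n a = a) (k : ℕ) : shift (n + k) a = shift k a := by
  rw [← shift_shift, h]

lemma exists_shift_eq_of_period {n : ℕ} (hn : 0 < n) (h : shift n a = a) (k : ℕ) :
    ∃ r < n, shift k a = shift r a := by
  induction k using Nat.strong_induction_on with
  | _ k ih =>
    rcases Nat.lt_or_ge k n with hk | hk
    · exact ⟨k, hk, rfl⟩
    · obtain ⟨t, rfl⟩ := Nat.exists_eq_add_of_le hk
      obtain ⟨r, hr, hrt⟩ := ih t (by omega)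
      exact ⟨r, hr, by rw [shift_eq_of_period h, hrt]⟩

/-- A periodic expansion of `1` with all reflected tails strictly smaller. -/
lemma mem_of_periodic (hq : 1 < q) (hqm : q < m + 1) (hbal : LexBal m a) (hv : val q a = 1)
    (hlt : ∀ i, LexLT (mirror m (shift i a)) a) (hper : ∃ n, 0 < n ∧ shift n a = a) :
    q ∈ twoBases m ∧ q ∈ iterTwoBases m 2 := by
  classical
  set n := Nat.find hper
  obtain ⟨hn, hna⟩ : 0 < n ∧ shift n a = a := Nat.find_spec hper
  have hmin : ∀ l, 0 < l → l < n → shift l a ≠ a := fun l hl hln h => Nat.find_min hper hln ⟨hl, h⟩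
  choose K hK hKlt using hlt
  simp only [mirror_apply, shift_apply] at hK hKlt
  obtain ⟨M, hM, hgood⟩ := exists_good hbal (fun i => ⟨K i, hK i, hKlt i⟩)
    (∑ l ∈ Finset.range n, K l + 1)
  refine mem_twoBases_and_iter_of_lexBal hq hqm hbal hv (fun h => ?_) hn hna hmin (by omega) hgood
    (fun h => by omega) fun l _ hl _ _ => ?_
  · have h1 := hKlt 0
    have h2 := congrFun h (K 0)
    rw [mirror_apply] at h2
    rw [zero_add] at h1
    omega
  · have h1 : K l ≤ ∑ l ∈ Finset.range n, K l :=
      Finset.single_le_sum (f := K) (fun _ _ => Nat.zero_le _) (Finset.mem_range.2 hl)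
    refine ⟨K l, by omega, fun j hj => ?_, ?_⟩
    · have := hK l j hj
      omega
    · have := hKlt l
      omega

/-- An expansion of `1` one of whose tails is its own reflection. -/
lemma mem_of_shift_eq_mirror (hq : 1 < q) (hqm : q < m + 1) (hbal : LexBal m a) (hv : val q a = 1)
    (hne : mirror m a ≠ a) (h1 : shift 1 a = mirror m a → m - a 0 < a 0 - 1)
    (hex : ∃ r, 0 < r ∧ shift r a = mirror m a) : q ∈ twoBases m ∧ q ∈ iterTwoBases m 2 := by
  classical
  set r := Nat.find hex
  obtain ⟨hr, hra⟩ : 0 < r ∧ shift r a = mirror m a := Nat.find_spec hex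
  have hmin : ∀ l, 0 < l → l < r → shift l a ≠ mirror m a := fun l hl hlr h =>
    Nat.find_min hex hlr ⟨hl, h⟩
  have h0 := hbal.head_gt hne
  have hgood := good_of_shift_eq_mirror hbal h0 hra hmin
  have hra' : ∀ t, a (r + t) = m - a t := fun t => congrFun hra t
  have hrr : shift (2 * r) a = a := by
    rw [two_mul, ← shift_shift, hra, ← mirror_shift, hra, mirror_mirror]
  have hr1 : r = 1 → m - a 0 < a 0 - 1 := fun h => h1 (by rw [← h]; exact hra)
  refine mem_twoBases_and_iter_of_lexBal hq hqm hbal hv hne (n := 2 * r) (by omega) hrr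
    (fun l hl hlr h => ?_) hr hgood hr1 fun l hl hlr hpre hlast => ?_
  · -- a smaller period would give a smaller index at which the tail is reflected
    rcases lt_trichotomy l r with hlt | rfl | hlt
    · refine hmin (r - l) (by omega) (by omega) ?_
      conv_lhs => rw [← h]
      rw [shift_shift, show l + (r - l) = r by omega, hra]
    · exact hne (hra.symm.trans h)
    · refine hmin (l - r) (by omega) (by omega) ?_
      have h2 : shift (l - r) (shift r a) = a := by
        rw [shift_shift, show r + (l - r) = l by omega, h]
      rw [hra, ← mirror_shift] at h2
      rw [← h2, mirror_mirror, h2]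
  · rcases lt_trichotomy l r with hlt | rfl | hlt
    · obtain ⟨k, hk, hka, hklt⟩ := hgood l hlt
      refine ⟨k, by omega, fun j hj => ?_, ?_⟩
      · have := hka j hj
        omega
      · omega
    · exfalso
      rcases Nat.eq_or_lt_of_le (Nat.succ_le_of_lt hr) with h2 | h2
      · have h3 := hr1 h2.symm
        have h4 := hra' 0
        rw [show 2 * r - 1 = r + 0 by omega, h4, show r - 1 = 0 by omega] at hlast
        omega
      · have h3 := hpre 0 (by omega)
        rw [show 2 * r - r + 0 = r + 0 by omega, hra'] at h3
        omega
    · obtain ⟨l', rfl⟩ := Nat.exists_eq_add_of_le hlt.le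
      refine ⟨0, by omega, fun _ h => absurd h (Nat.not_lt_zero _), ?_⟩
      have h3 := hpre l' (by omega)
      rw [show 2 * r - (r + l') + l' = r + 0 by omega, hra'] at h3
      rw [add_zero, hra']
      omega

/-! ### The generalized golden ratio -/

lemma goldenRatio_even (k : ℕ) : goldenRatio (2 * k) = k + 1 := by
  simp [goldenRatio]

lemma eq_goldenRatio_odd {k : ℕ} (hq : 0 < q) (h : q ^ 2 = (k + 1) * (q + 1)) :
    q = goldenRatio (2 * k + 1) := by
  have hk : (0 : ℝ) ≤ k := by positivity
  have h1 : (2 * k + 1) / 2 = k := by omega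
  have h2 : (0 : ℝ) ≤ 2 * q - (k + 1) := by
    by_contra! hc
    nlinarith
  have h3 : √((k : ℝ) ^ 2 + 6 * k + 5) = 2 * q - (k + 1) := by
    rw [show (k : ℝ) ^ 2 + 6 * k + 5 = (2 * q - (k + 1)) ^ 2 by nlinarith, Real.sqrt_sq h2]
  simp only [goldenRatio, h1, h3, Nat.not_even_bit1, if_false]
  ring

lemma goldenRatio_odd_sq (k : ℕ) :
    0 < goldenRatio (2 * k + 1) ∧
      goldenRatio (2 * k + 1) ^ 2 = (k + 1) * (goldenRatio (2 * k + 1) + 1) := by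
  have h1 : (2 * k + 1) / 2 = k := by omega
  have h2 := Real.sq_sqrt (show (0 : ℝ) ≤ (k : ℝ) ^ 2 + 6 * k + 5 by positivity)
  simp only [goldenRatio, h1, Nat.not_even_bit1, if_false]
  constructor
  · positivity
  · nlinarith

lemma IsQf.goldenRatio_lt {Q : ℝ} (h : IsQf m Q) : goldenRatio m < Q := by
  obtain ⟨k, h1, h2, ⟨rfl, -, h3⟩ | ⟨rfl, h3⟩⟩ := h
  · rwa [goldenRatio_even]
  · obtain ⟨hG, hG2⟩ := goldenRatio_odd_sq k
    have hk : (0 : ℝ) ≤ k := by positivity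
    by_contra! hc
    have h4 : Q ^ 2 - (k + 1) * Q - (k + 1) ≤ 0 := by nlinarith
    have h5 : Q * (Q ^ 2 - (k + 1) * Q - (k + 1)) ≤ 0 :=
      mul_nonpos_of_nonneg_of_nonpos (by linarith) h4
    nlinarith [mul_pos (show (0 : ℝ) < Q - 1 by linarith) (show (0 : ℝ) < Q - (k + 1) by linarith)]

/-! ### Bases in `V` -/

lemma top_mem_univoqueBases (hm : 1 ≤ m) : ((m : ℝ) + 1) ∈ univoqueBases m := by
  have hm' : (1 : ℝ) ≤ m := by exact_mod_cast hm
  refine mem_univoqueBases_iff.2 ⟨⟨by linarith, le_rfl⟩, fun _ => m,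
    ⟨fun _ => ⟨by positivity, le_rfl⟩, fun n => ⟨fun h => absurd h (lt_irrefl _), fun _ => ?_⟩⟩, ?_⟩
  · have : mirror m (shift (n + 1) fun _ => (m : ℤ)) = fun _ => 0 := by ext i; simp
    rw [this, val_zero]; exact zero_lt_one
  · rw [val_const (by linarith)]
    push_cast
    rw [add_sub_cancel_right, div_self (by linarith)]

/-- For `q ∈ V \ U` with `q` different from the generalized golden ratio, a tail of the
quasi-greedy expansion `a` of `1` has value `1`, or its reflection has; by the lexicographic
conditions that tail is `a` or the reflection of `a`. -/
lemma mem_of_mem_vBases (hm : 1 ≤ m) (hV : q ∈ vBases m) (hG : q ≠ goldenRatio m)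
    (hU : q ∉ univoqueBases m) : q ∈ twoBases m ∧ q ∈ iterTwoBases m 2 := by
  obtain ⟨a, hB, hv⟩ := exists_bal_of_mem_vBases hV
  obtain ⟨⟨hq, hqm'⟩, -⟩ := hV
  have hqm : q < m + 1 := lt_of_le_of_ne hqm' fun h => hU (h ▸ top_mem_univoqueBases hm)
  have hbal := hB.lexBal hq hqm hv
  have hpos : ∀ n, 0 < val q (shift n a) := fun n => (hB.tail_pos hq hqm n).1
  have hne : mirror m a ≠ a := by
    intro h
    have h1 : ∀ i, m - a i = a i := fun i => congrFun h i
    have h2 : a = fun _ => a 0 := funext fun i => by have := h1 i; have := h1 0; omega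
    rw [h2, val_const hq, div_eq_one_iff_eq (by linarith)] at hv
    obtain ⟨k, hk⟩ := Int.eq_ofNat_of_zero_le (hbal.1 0).1
    have h3 : m = 2 * k := by have := h1 0; omega
    subst h3
    rw [hk] at hv
    push_cast at hv
    exact hG (by rw [goldenRatio_even]; linarith)
  have h0 := hbal.head_gt hne
  by_cases hr : ∃ r, 0 < r ∧ shift r a = mirror m a
  · refine mem_of_shift_eq_mirror hq hqm hbal hv hne (fun h1 => ?_) hr
    by_contra hc
    have h2 : 2 * a 0 = m + 1 := by omega
    obtain ⟨k, hk⟩ := Int.eq_ofNat_of_zero_le (show 0 ≤ a 0 - 1 by have := hbal.1 0; omega)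
    have h3 : m = 2 * k + 1 := by omega
    subst h3
    have h4 := val_head hbal.1 hq
    rw [h1, val_mirror hbal.1 hq, hv, show a 0 = k + 1 by omega] at h4
    refine hG (eq_goldenRatio_odd (by linarith) ?_)
    have h5 : q - 1 ≠ 0 := by linarith
    push_cast at h4
    field_simp at h4
    nlinarith
  · push Not at hr
    have hlt : ∀ i, LexLT (mirror m (shift i a)) a := by
      intro i
      rcases Nat.eq_zero_or_pos i with rfl | hi
      · exact ⟨0, fun _ h => absurd h (Nat.not_lt_zero _), by simpa using h0⟩
      · rcases (hbal.2 i).2 with h | h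
        · exact absurd (by rw [← mirror_mirror (m := m) (shift i a), h]) (hr i hi)
        · exact h
    refine mem_of_periodic hq hqm hbal hv hlt ?_
    by_contra! hper
    refine hU (mem_univoqueBases_iff.2 ⟨⟨hq, hqm'⟩, a, Uni.of_tails hbal.1 fun n => ⟨?_, ?_⟩, hv⟩)
    · refine val_lt_one_of_lexLT hbal.1 hv hpos (hbal.1.shift _) hq (fun k => ?_) ?_
      · rw [shift_shift]; exact (hB.2 _).1
      · exact (hbal.2 (n + 1)).1.resolve_left (hper (n + 1) (Nat.succ_pos n))
    · refine val_lt_one_of_lexLT hbal.1 hv hpos (hbal.1.shift _).mirror hq (fun k => ?_)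
        (hlt (n + 1))
      rw [← mirror_shift, shift_shift]; exact (hB.2 _).2

/-! ### A subset of `B₂` without isolated points -/

/-- The bases smaller than `m + 1` in which `1` has a periodic expansion that dominates its tails
and strictly dominates their reflections. -/
def periodicBases (m : ℕ) : Set ℝ :=
  {q | 1 < q ∧ q < m + 1 ∧ ∃ a, LexBal m a ∧ val q a = 1 ∧
    (∀ i, LexLT (mirror m (shift i a)) a) ∧ ∃ n, 0 < n ∧ shift n a = a}

lemma lt_top_of_val (ha : Dig m a) (hq : 1 < q) (hv : val q a = 1) {i : ℕ} (hi : a i ≠ m) :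
    q < m + 1 := by
  have h1 := val_pos ha.mirror hq (i := i) (by simp only [mirror_apply]; omega)
  rw [val_mirror ha hq, hv] at h1
  have h2 : 1 < (m : ℝ) / (q - 1) := by linarith
  rw [lt_div_iff₀ (by linarith)] at h2
  linarith

lemma exists_prefix_close (hq : 1 < q) {ε : ℝ} (hε : 0 < ε) :
    ∃ K, ∀ a b, Dig m a → Dig m b → (∀ i < K, a i = b i) → |val q a - val q b| < ε := by
  have hlim : Tendsto (fun j : ℕ => (m / (q - 1)) / q ^ j) atTop (𝓝 0) :=
    tendsto_const_nhds.div_atTop (tendsto_pow_atTop_atTop_of_one_lt hq)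
  obtain ⟨K, hK⟩ := (hlim.eventually (gt_mem_nhds hε)).exists
  refine ⟨K, fun a b ha hb h => lt_of_le_of_lt ?_ hK⟩
  have h1 : ∑ i ∈ Finset.range K, (a i : ℝ) / q ^ (i + 1)
      = ∑ i ∈ Finset.range K, (b i : ℝ) / q ^ (i + 1) :=
    Finset.sum_congr rfl fun i hi => by rw [h i (Finset.mem_range.1 hi)]
  rw [val_split ha hq K, val_split hb hq K, h1, add_sub_add_left_eq_sub, ← sub_div, abs_div,
    abs_of_pos (show (0 : ℝ) < q ^ K by positivity)]
  have h2 := val_nonneg (ha.shift K) hq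
  have h3 := val_le (ha.shift K) hq
  have h4 := val_nonneg (hb.shift K) hq
  have h5 := val_le (hb.shift K) hq
  gcongr
  exact abs_le.2 ⟨by linarith, by linarith⟩

/-- If `a` has value `1` in base `q`, then sequences with a long common prefix with `a` have value
`1` in bases close to `q`. -/
lemma exists_base_near (ha : Dig m a) (hq : 1 < q) (hv : val q a = 1) {ε : ℝ} (hε : 0 < ε) :
    ∃ K, ∀ b, Dig m b → (∀ i < K, b i = a i) → ∃ p, 1 < p ∧ |p - q| < ε ∧ val p b = 1 := by
  obtain ⟨q₁, hq₁, hq₁q⟩ : ∃ q₁, max 1 (q - ε) < q₁ ∧ q₁ < q :=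
    exists_between (max_lt hq (by linarith))
  obtain ⟨q₂, hq₂, hq₂q⟩ : ∃ q₂, q < q₂ ∧ q₂ < q + ε := exists_between (by linarith)
  have h1 : 1 < q₁ := (le_max_left _ _).trans_lt hq₁
  have h2 : q - ε < q₁ := (le_max_right _ _).trans_lt hq₁
  have hv0 : 0 < val q a := by linarith
  obtain ⟨i, hi⟩ := exists_ne_zero_of_val_pos hv0
  have hv1 : 1 < val q₁ a := hv ▸ val_strictAnti ha h1 hq₁q (val_pos ha h1 hi)
  have hv2 : val q₂ a < 1 := hv ▸ val_strictAnti ha hq hq₂ hv0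
  obtain ⟨K₁, hK₁⟩ := exists_prefix_close (m := m) h1 (sub_pos.2 hv1)
  obtain ⟨K₂, hK₂⟩ := exists_prefix_close (m := m) (hq.trans hq₂) (sub_pos.2 hv2)
  refine ⟨max K₁ K₂, fun b hb hab => ?_⟩
  have h3 := abs_lt.1 (hK₁ b a hb ha fun i hi => hab i (lt_max_of_lt_left hi))
  have h4 := abs_lt.1 (hK₂ b a hb ha fun i hi => hab i (lt_max_of_lt_right hi))
  have hcont : ContinuousOn (fun p => val p b) (Icc q₁ q₂) := fun p hp =>
    (continuousAt_val hb (h1.trans_le hp.1)).continuousWithinAt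
  obtain ⟨p, hp, hpv⟩ := intermediate_value_Icc' (hq₁q.trans hq₂).le hcont
    (show (1 : ℝ) ∈ Icc (val q₂ b) (val q₁ b) from ⟨by linarith, by linarith⟩)
  refine ⟨p, h1.trans_le hp.1, abs_lt.2 ⟨?_, ?_⟩, hpv⟩
  · have := hp.1; linarith
  · have := hp.2; linarith

/-- For a periodic sequence, lowering the last digit of a sufficiently long good prefix and
repeating the resulting word yields a sequence with the same properties. -/
lemma Good.loweredPeriodic_lexBal {n M : ℕ} (h : Good m a M) (hbal : LexBal m a)
    (hlt : ∀ i, LexLT (mirror m (shift i a)) a) (hn : 0 < n) (hper : shift n a = a)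
    (hM : 2 * n + 1 ≤ M) (h0 : m - a 0 < a 0) :
    LexBal m (loweredPeriodic M a) ∧
      ∀ i, LexLT (mirror m (shift i (loweredPeriodic M a))) (loweredPeriodic M a) := by
  have hM0 : 0 < M := by omega
  set g := loweredPeriodic M a with hg
  have hd : Dig m g := h.dig_loweredPeriodic hM0 hbal.1
  have hga := h.loweredPeriodic_lexLT hM0 hbal h0 (fun h => by omega)
  have hpre : ∀ i < M - 1, g i = a i := fun i hi => loweredPeriodic_prefix M a hi
  have hgM : shift M g = g := shift_loweredPeriodic M a
  have hgM' : ∀ t, g (M + t) = g t := fun t => congrFun hgM t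
  have hlast : g (M - 1) = a (M - 1) - 1 := by
    rw [hg, loweredPeriodic, Nat.mod_eq_of_lt (by omega), lowered, if_pos rfl]
  -- agreement with the reflection on a full period contradicts the strict inequality
  have hfull : ∀ i, ¬ ∀ t < n, a (i + t) = m - a t := by
    intro i hi
    have hmod : ∀ t, a t = a (t % n) := by
      intro t
      induction t using Nat.strong_induction_on with
      | _ t ih =>
        rcases Nat.lt_or_ge t n with ht | ht
        · rw [Nat.mod_eq_of_lt ht]
        · obtain ⟨s, rfl⟩ := Nat.exists_eq_add_of_le ht
          rw [Nat.add_mod_left, ← ih s (by omega)]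
          exact congrFun hper s
    have h1 : mirror m (shift i a) = a := by
      ext t
      have h2 := hi (t % n) (Nat.mod_lt _ hn)
      have h3 : a (i + t) = a (i + t % n) := by
        rw [hmod (i + t), hmod (i + t % n), Nat.add_mod_mod]
      rw [mirror_apply, shift_apply, h3, h2, hmod t]
      ring
    have h2 := hlt i
    rw [h1] at h2
    exact LexLT.irrefl _ h2
  have hup : ∀ i < M, LexLE (shift i g) g := by
    intro i hi
    rcases lexLT_or_eq_or_lexLT (shift i g) g with h1 | h1 | h1
    · exact h1.le
    · exact Or.inl h1
    · exfalso
      have hb := prefix_eq_of_between h1.le (hga i).1 hpre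
      simp only [shift_apply] at hb
      have hi0 : 0 < i := by
        by_contra hi0
        obtain rfl : i = 0 := by omega
        rw [shift_zero] at h1
        exact LexLT.irrefl _ h1
      refine (hbal.2 i).1.not_lt ⟨M - 1 - i, fun t ht => ?_, ?_⟩
      · rw [shift_apply, ← hpre (i + t) (by omega), hb t (by omega)]
      · have h2 := hb (M - 1 - i) (by omega)
        rw [show i + (M - 1 - i) = M - 1 by omega, hlast] at h2
        rw [shift_apply, show i + (M - 1 - i) = M - 1 by omega]
        omega
  have hlow : ∀ i < M, LexLT (mirror m (shift i g)) g := by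
    intro i hi
    rcases lexLT_or_eq_or_lexLT (mirror m (shift i g)) g with h1 | h1
    · exact h1
    · exfalso
      have hle : LexLE g (mirror m (shift i g)) := by
        rcases h1 with h1 | h1
        · exact Or.inl h1.symm
        · exact h1.le
      have hb := prefix_eq_of_between hle (hga i).2 hpre
      simp only [shift_apply, mirror_apply] at hb
      rcases Nat.lt_or_ge (i + n) M with h2 | h2
      · refine hfull i fun t ht => ?_
        have h3 := hb t (by omega)
        rcases Nat.lt_or_ge (i + t) (M - 1) with h4 | h4
        · rw [hpre _ h4] at h3
          omega
        · omega
      · refine hfull (M - i) fun t ht => ?_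
        have h3 := hb (M - i + t) (by omega)
        rw [show i + (M - i + t) = M + t by omega, hgM', hpre t (by omega)] at h3
        omega
  refine ⟨⟨hd, fun k => ?_⟩, fun k => ?_⟩
  · obtain ⟨r, hr, hrk⟩ := exists_shift_eq_of_period hM0 hgM k
    rw [hrk]
    exact ⟨hup r hr, (hlow r hr).le⟩
  · obtain ⟨r, hr, hrk⟩ := exists_shift_eq_of_period hM0 hgM k
    rw [hrk]
    exact hlow r hr

lemma accPt_periodicBases (h : q ∈ periodicBases m) : AccPt q (𝓟 (periodicBases m)) := by
  obtain ⟨hq, hqm, a, hbal, hv, hlt, n, hn, hper⟩ := h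
  refine accPt_iff_frequently.2 (frequently_nhds_iff.2 fun U hU hUo => ?_)
  obtain ⟨ε, hε, hball⟩ := Metric.isOpen_iff.1 hUo q hU
  obtain ⟨K, hK⟩ := exists_base_near hbal.1 hq hv hε
  obtain ⟨M, hM, hgood⟩ := exists_good hbal hlt (2 * n + 1 + K)
  have hM0 : 0 < M := by omega
  have h0 : m - a 0 < a 0 := hbal.head_gt fun h => by
    have h1 := hlt 0
    rw [shift_zero, h] at h1
    exact LexLT.irrefl _ h1
  obtain ⟨hgbal, hglt⟩ := hgood.loweredPeriodic_lexBal hbal hlt hn hper (by omega) h0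
  obtain ⟨p, hp, hpq, hpv⟩ := hK _ hgbal.1 fun i hi => loweredPeriodic_prefix M a (by omega)
  have hB := hbal.bal hq hv
  have hgq : val q (loweredPeriodic M a) < 1 := by
    have hga := hgood.loweredPeriodic_lexLT hM0 hbal h0 fun h => by omega
    refine val_lt_one_of_lexLT hbal.1 hv (fun n => (hB.tail_pos hq hqm n).1) hgbal.1 hq
      (fun k => val_le_one_of_lexLE hbal.1 hv (hgbal.1.shift k) hq fun j => ?_)
      (by simpa using (hga 0).1)
    rw [shift_shift]
    exact (hga _).1.le
  refine ⟨p, hball (by rwa [Metric.mem_ball, Real.dist_eq]), ?_, hp, ?_, _, hgbal, hpv, hglt, M,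
    hM0, shift_loweredPeriodic M a⟩
  · rintro rfl
    linarith
  · refine lt_top_of_val hgbal.1 hp hpv (i := M - 1) ?_
    rw [loweredPeriodic, Nat.mod_eq_of_lt (by omega), lowered, if_pos rfl]
    have := hbal.1 (M - 1)
    omega

/-- The sequence obtained by repeating the smallest period of a good prefix of `a` has this
prefix as well, and it dominates its tails and strictly dominates their reflections. -/
lemma Good.exists_periodic {N : ℕ} (h : Good m a N) (hN : 0 < N) (hbal : LexBal m a) :
    ∃ b, LexBal m b ∧ (∀ i, LexLT (mirror m (shift i b)) b) ∧ (∃ n, 0 < n ∧ shift n b = b) ∧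
      ∀ i < N, b i = a i := by
  classical
  have hex : ∃ p, 0 < p ∧ ∀ j, p + j < N → a (p + j) = a j := ⟨N, hN, fun j hj => by omega⟩
  set p := Nat.find hex
  obtain ⟨hp, hpa⟩ : 0 < p ∧ ∀ j, p + j < N → a (p + j) = a j := Nat.find_spec hex
  have hpN : p ≤ N := Nat.find_min' hex ⟨hN, fun j hj => by omega⟩
  let b : ℕ → ℤ := fun i => a (i % p)
  have hpre : ∀ i < N, b i = a i := by
    intro i
    induction i using Nat.strong_induction_on with
    | _ i ih =>
      intro hi
      rcases Nat.lt_or_ge i p with h1 | h1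
      · simp only [b]; rw [Nat.mod_eq_of_lt h1]
      · obtain ⟨j, rfl⟩ := Nat.exists_eq_add_of_le h1
        rw [hpa j hi, ← ih j (by omega) (by omega)]
        simp only [b]; rw [Nat.add_mod_left]
  have hper : shift p b = b := by ext i; simp [b]
  have hup : ∀ r < p, LexLE (shift r b) b := by
    intro r hr
    rcases Nat.eq_zero_or_pos r with rfl | hr0
    · exact Or.inl (shift_zero b)
    · -- `r` is not a period of the prefix, so the comparison of `a` is decided within it
      have h1 : ∃ j, r + j < N ∧ a (r + j) ≠ a j := by
        have := Nat.find_min hex hr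
        push Not at this
        exact this hr0
      obtain ⟨j, hj, hne⟩ := h1
      rcases (hbal.2 r).1 with heq | ⟨k, hk, hlt⟩
      · exact absurd (congrFun heq j) hne
      · have hkj : k ≤ j := by
          by_contra! hc
          exact hne (hk j hc)
        simp only [shift_apply] at hk hlt
        refine Or.inr ⟨k, fun i hi => ?_, ?_⟩
        · rw [shift_apply, hpre _ (by omega), hpre _ (by omega), hk i hi]
        · rwa [shift_apply, hpre _ (by omega), hpre _ (by omega)]
  have hlow : ∀ r < p, LexLT (mirror m (shift r b)) b := by
    intro r hr
    obtain ⟨k, hkN, hk, hlt⟩ := h r (by omega)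
    refine ⟨k, fun i hi => ?_, ?_⟩
    · rw [mirror_apply, shift_apply, hpre _ (by omega), hpre _ (by omega), hk i hi]
    · rwa [mirror_apply, shift_apply, hpre _ (by omega), hpre _ (by omega)]
  refine ⟨b, ⟨fun i => hbal.1 _, fun k => ?_⟩, fun k => ?_, ⟨p, hp, hper⟩, hpre⟩
  · obtain ⟨r, hr, hrk⟩ := exists_shift_eq_of_period hp hper k
    rw [hrk]
    exact ⟨hup r hr, (hlow r hr).le⟩
  · obtain ⟨r, hr, hrk⟩ := exists_shift_eq_of_period hp hper k
    rw [hrk]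
    exact hlow r hr

/-- The periodic sequence with period word `m^N 0`. -/
lemma exists_periodic_near_top (hm : 1 ≤ m) (N : ℕ) :
    ∃ b, LexBal m b ∧ (∀ i, LexLT (mirror m (shift i b)) b) ∧ (∃ n, 0 < n ∧ shift n b = b) ∧
      (∃ i, b i ≠ m) ∧ ∀ i < N, b i = m := by
  let L := N + 2
  let b : ℕ → ℤ := fun i => if i % (L + 1) = L then 0 else m
  have hb : ∀ i < L, b i = m := fun i hi => by
    simp only [b]; rw [Nat.mod_eq_of_lt (by omega), if_neg hi.ne]
  have hbL : b L = 0 := by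
    simp only [b]; rw [Nat.mod_eq_of_lt (by omega), if_pos rfl]
  have hper : shift (L + 1) b = b := by ext i; simp [b]
  have hd : Dig m b := fun i => by simp only [b]; split_ifs <;> omega
  have hup : ∀ r < L + 1, LexLE (shift r b) b := by
    intro r hr
    rcases Nat.eq_zero_or_pos r with rfl | hr0
    · exact Or.inl (shift_zero b)
    · refine Or.inr ⟨L - r, fun i hi => ?_, ?_⟩
      · rw [shift_apply, hb _ (by omega), hb _ (by omega)]
      · rw [shift_apply, show r + (L - r) = L by omega, hbL, hb _ (by omega)]
        omega
  have hlow : ∀ r < L + 1, LexLT (mirror m (shift r b)) b := by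
    intro r hr
    rcases Nat.lt_or_ge r L with h | h
    · refine ⟨0, fun _ h => absurd h (Nat.not_lt_zero _), ?_⟩
      rw [mirror_apply, shift_apply, add_zero, hb r h, hb 0 (by omega)]
      omega
    · obtain rfl : r = L := by omega
      have h1 : b (L + 1) = m := (congrFun hper 0).trans (hb 0 (by omega))
      refine ⟨1, fun i hi => ?_, ?_⟩
      · obtain rfl : i = 0 := by omega
        rw [mirror_apply, shift_apply, add_zero, hbL, hb 0 (by omega)]
        omega
      · rw [mirror_apply, shift_apply, h1, hb 1 (by omega)]
        omega
  refine ⟨b, ⟨hd, fun k => ?_⟩, fun k => ?_, ⟨L + 1, Nat.succ_pos _, hper⟩, ⟨L, ?_⟩,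
    fun i hi => hb i (by omega)⟩
  · obtain ⟨r, hr, hrk⟩ := exists_shift_eq_of_period (Nat.succ_pos L) hper k
    rw [hrk]
    exact ⟨hup r hr, (hlow r hr).le⟩
  · obtain ⟨r, hr, hrk⟩ := exists_shift_eq_of_period (Nat.succ_pos L) hper k
    rw [hrk]
    exact hlow r hr
  · rw [hbL]; omega

lemma univoqueBases_subset_closure (hm : 1 ≤ m) : univoqueBases m ⊆ closure (periodicBases m) := by
  intro q hqU
  obtain ⟨⟨hq, hqm'⟩, a, ha, hv⟩ := mem_univoqueBases_iff.1 hqU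
  refine Metric.mem_closure_iff.2 fun ε hε => ?_
  obtain ⟨K, hK⟩ := exists_base_near ha.1 hq hv hε
  obtain ⟨b, hbal, hlt, hper, ⟨i, hi⟩, hpre⟩ : ∃ b, LexBal m b ∧
      (∀ i, LexLT (mirror m (shift i b)) b) ∧ (∃ n, 0 < n ∧ shift n b = b) ∧ (∃ i, b i ≠ m) ∧
      ∀ i < K, b i = a i := by
    by_cases hex : ∃ p, a p ≠ m
    · obtain ⟨p, hp⟩ := hex
      have hqm := lt_top_of_val ha.1 hq hv hp
      have hbal := (ha.weakUni.bal hq hqm' hv).lexBal hq hqm hv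
      have ha0 : a 0 ≠ 0 := by
        intro h
        have h1 := val_head ha.1 hq
        rw [hv, h] at h1
        have h2 := ((ha.weakUni.bal hq hqm' hv).2 1).1
        push_cast at h1
        linarith
      have hlt : ∀ i, LexLT (mirror m (shift i a)) a := by
        intro i
        refine (hbal.2 i).2.resolve_left fun h => ?_
        rcases Nat.eq_zero_or_pos i with rfl | hi0
        · -- then all digits equal `m / 2` and `a` would not be a unique expansion
          have h1 : ∀ i, m - a i = a i := fun i => by simpa using congrFun h i
          have h2 : shift (0 + 1) a = a :=
            funext fun i => by have := h1 i; have := h1 (0 + 1 + i); rw [shift_apply]; omega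
          have h3 := (ha.2 0).1 (by have := h1 0; have := (ha.1 0).1; omega)
          rw [h2, hv] at h3
          exact lt_irrefl _ h3
        · have h1 := ha.mirror_tail_lt hq hqm' ha0 hi0
          rw [h, hv] at h1
          exact lt_irrefl _ h1
      obtain ⟨N, hN, hgood⟩ := exists_good hbal hlt (K + p)
      obtain ⟨b, hb1, hb2, hb3, hb4⟩ := hgood.exists_periodic (by omega) hbal
      exact ⟨b, hb1, hb2, hb3, ⟨p, by rwa [hb4 p (by omega)]⟩, fun i hi => hb4 i (by omega)⟩
    · push Not at hex
      obtain ⟨b, hb1, hb2, hb3, hb4, hb5⟩ := exists_periodic_near_top hm K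
      exact ⟨b, hb1, hb2, hb3, hb4, fun i hi => by rw [hb5 i hi, hex i]⟩
  obtain ⟨p, hp, hpq, hpv⟩ := hK b hbal.1 hpre
  refine ⟨p, ⟨hp, lt_top_of_val hbal.1 hp hpv hi, b, hbal, hpv, hlt, hper⟩, ?_⟩
  rwa [dist_comm, Real.dist_eq]

/-! ### The base `q_f` -/

/-- In base `q_f` the expansion `((k+1) (k-1))^∞`, respectively `((k+1) (k+1) k k)^∞`, of `1` is
balanced. -/
lemma IsQf.mem_vBases {Q : ℝ} (h : IsQf m Q) : Q ∈ vBases m := by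
  have hQ1 := h.one_lt
  have hQm := h.lt
  obtain ⟨k, h1, h2, ⟨rfl, hk1, heq⟩ | ⟨rfl, heq⟩⟩ := h
  · let a : ℕ → ℤ := fun i => if Even i then k + 1 else k - 1
    have ha : Dig (2 * k) a := fun i => by
      simp only [a]; split_ifs <;> push_cast <;> omega
    have h3 : shift 1 a = mirror (2 * k) a := by
      ext i
      simp only [a, shift_apply, mirror_apply, add_comm 1 i, Nat.even_add_one]
      by_cases hi : Even i <;> simp only [hi, not_true_eq_false, not_false_eq_true, if_true,
        if_false] <;> push_cast <;> ring
    have hv : val Q a = 1 := by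
      have h4 := val_head ha hQ1
      rw [h3, val_mirror ha hQ1] at h4
      have h5 : a 0 = k + 1 := by simp [a]
      rw [h5] at h4
      push_cast at h4
      have h6 : Q - 1 ≠ 0 := by linarith
      field_simp at h4
      have h7 : (Q ^ 2 - 1) * (val Q a - 1) = 0 := by linear_combination h4 - heq
      have h8 : Q ^ 2 - 1 ≠ 0 := by nlinarith
      rcases mul_eq_zero.1 h7 with h | h
      · exact absurd h h8
      · linarith
    have hle : val Q (mirror (2 * k) a) ≤ 1 := by
      rw [val_mirror ha hQ1, hv, sub_le_iff_le_add, div_le_iff₀ (by linarith)]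
      push_cast
      linarith
    refine mem_vBases_of_weakUni ⟨hQ1, hQm.le⟩ (Bal.weakUni ⟨ha, fun n => ?_⟩) hv
    induction n with
    | zero => exact ⟨by simpa using hv.le, by simpa using hle⟩
    | succ n ih =>
      have h4 : shift (n + 1) a = mirror (2 * k) (shift n a) := by
        rw [add_comm, ← shift_shift, h3, mirror_shift]
      rw [h4, mirror_mirror]
      exact ih.symm
  · let a : ℕ → ℤ := fun i => if i % 4 < 2 then k + 1 else k
    have ha : Dig (2 * k + 1) a := fun i => by
      simp only [a]; split_ifs <;> push_cast <;> omega
    have h3 : shift 2 a = mirror (2 * k + 1) a := by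
      ext i
      simp only [a, shift_apply, mirror_apply]
      by_cases hi : i % 4 < 2
      · rw [if_pos hi, if_neg (by omega)]; push_cast; ring
      · rw [if_neg hi, if_pos (by omega)]; push_cast; ring
    have h4 := val_head ha hQ1
    have h5 := val_shift ha hQ1 1
    rw [show a 0 = k + 1 from if_pos (by norm_num)] at h4
    rw [show a 1 = k + 1 from if_pos (by norm_num), h3, val_mirror ha hQ1] at h5
    push_cast at h4 h5
    have hk : (0 : ℝ) ≤ k := by positivity
    have hv : val Q a = 1 := by
      have h6 : Q - 1 ≠ 0 := by linarith
      have h7 : val Q (shift 1 a) = Q * val Q a - (k + 1) := by linarith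
      rw [h7] at h5
      field_simp at h5
      have h8 : ((Q ^ 2 + 1) * (Q - 1)) * (val Q a - 1) = 0 := by linear_combination h5 - heq
      rcases mul_eq_zero.1 h8 with h | h
      · exact absurd h (mul_pos (by positivity) (by linarith)).ne'
      · linarith
    rw [hv] at h4
    have hbig : ((2 * k + 1 : ℕ) : ℝ) < 2 * (Q - 1) :=
      IsQf.two_mul_gt ⟨k, h1, h2, Or.inr ⟨rfl, heq⟩⟩
    have hle : val Q (mirror (2 * k + 1) a) ≤ 1 := by
      rw [val_mirror ha hQ1, hv, sub_le_iff_le_add, div_le_iff₀ (by linarith)]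
      linarith
    have hle1 : val Q (mirror (2 * k + 1) (shift 1 a)) ≤ 1 := by
      rw [val_mirror (ha.shift 1) hQ1, show val Q (shift 1 a) = Q - (k + 1) by linarith,
        sub_le_iff_le_add, div_le_iff₀ (by linarith)]
      push_cast
      nlinarith
    refine mem_vBases_of_weakUni ⟨hQ1, hQm.le⟩ (Bal.weakUni ⟨ha, fun n => ?_⟩) hv
    induction n using Nat.twoStepInduction with
    | zero => exact ⟨by simpa using hv.le, by simpa using hle⟩
    | one => exact ⟨by linarith, hle1⟩
    | more n ih _ =>
      have h6 : shift (n + 2) a = mirror (2 * k + 1) (shift n a) := by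
        rw [add_comm, ← shift_shift, h3, mirror_shift]
      rw [h6, mirror_mirror]
      exact ih.symm

lemma exists_isQf_even (k : ℕ) (hk : 1 ≤ k) :
    ∃ Q, IsQf (2 * k) Q ∧ IsGreatest {q : ℝ | q ^ 2 - ((k : ℝ) + 1) * q - (k : ℝ) = 0} Q := by
  have hk' : (1 : ℝ) ≤ k := by exact_mod_cast hk
  obtain ⟨Q, hQ, hQ0⟩ := intermediate_value_Ioo (f := fun q : ℝ => q ^ 2 - ((k : ℝ) + 1) * q - k)
    (show (k : ℝ) + 1 ≤ k + 2 by linarith) (by fun_prop)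
    (show (0 : ℝ) ∈ Ioo _ _ from ⟨by nlinarith, by nlinarith⟩)
  refine ⟨Q, ⟨k, hQ.1, hQ.2, Or.inl ⟨rfl, hk, hQ0⟩⟩, hQ0, fun x hx => ?_⟩
  by_contra! hc
  have h1 : x ^ 2 - ((k : ℝ) + 1) * x - k = 0 := hx
  have h2 : Q ^ 2 - ((k : ℝ) + 1) * Q - k = 0 := hQ0
  have h3 := hQ.1
  nlinarith [mul_pos (sub_pos.2 hc) (show (0 : ℝ) < x + Q - (k + 1) by linarith)]

lemma exists_isQf_odd (k : ℕ) :
    ∃ Q, IsQf (2 * k + 1) Q ∧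
      IsGreatest {q : ℝ | q ^ 3 - ((k : ℝ) + 2) * q ^ 2 + q - (k : ℝ) - 1 = 0} Q := by
  have hk : (0 : ℝ) ≤ k := by positivity
  obtain ⟨Q, hQ, hQ0⟩ := intermediate_value_Ioo
    (f := fun q : ℝ => q ^ 3 - ((k : ℝ) + 2) * q ^ 2 + q - k - 1)
    (show (k : ℝ) + 1 ≤ k + 2 by linarith) (by fun_prop)
    (show (0 : ℝ) ∈ Ioo _ _ from ⟨by nlinarith [sq_nonneg (k : ℝ)], by nlinarith⟩)
  refine ⟨Q, ⟨k, hQ.1, hQ.2, Or.inr ⟨rfl, hQ0⟩⟩, hQ0, fun x hx => ?_⟩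
  by_contra! hc
  have h1 : x ^ 3 - ((k : ℝ) + 2) * x ^ 2 + x - k - 1 = 0 := hx
  have h2 : Q ^ 3 - ((k : ℝ) + 2) * Q ^ 2 + Q - k - 1 = 0 := hQ0
  have h3 := hQ.1
  have h5 : x ^ 2 * (k + 2 - x) = x - k - 1 := by linarith
  have hx0 : 0 < x := by linarith
  have h6 : 0 < k + 2 - x := by
    by_contra! hcon
    nlinarith [mul_nonneg (sq_nonneg x) (sub_nonneg.2 hcon)]
  -- the remaining factor has no zero with `x > Q`
  have h7 : (x - Q) * (x ^ 2 + x * Q + Q ^ 2 - (k + 2) * (x + Q) + 1) = 0 := by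
    linear_combination h1 - h2
  rcases mul_eq_zero.1 h7 with h | h
  · linarith
  · have h8 : (1 : ℝ) < Q := by linarith
    nlinarith [mul_pos (sub_pos.2 hc) (sub_pos.2 h3), mul_pos h6 (sub_pos.2 h3)]

lemma exists_isQf (hm : 1 ≤ m) : ∃ Q, IsQf m Q := by
  obtain ⟨k, rfl | rfl⟩ := Nat.even_or_odd' m
  · obtain ⟨Q, hQ, -⟩ := exists_isQf_even k (by omega)
    exact ⟨Q, hQ⟩
  · obtain ⟨Q, hQ, -⟩ := exists_isQf_odd k
    exact ⟨Q, hQ⟩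

/-! ### The sets `B₂⁽ⁱ⁾` -/

lemma univoqueBases_subset_twoBases (hm : 1 ≤ m) : univoqueBases m ⊆ twoBases m := by
  intro q hqU
  obtain ⟨⟨hq, hqm⟩, a, ha, hv⟩ := mem_univoqueBases_iff.1 hqU
  have hm' : (1 : ℝ) ≤ m := by exact_mod_cast hm
  have hz : Uni m q fun _ => 0 := by
    refine ⟨fun _ => ⟨le_rfl, by positivity⟩, fun n => ⟨fun _ => ?_, fun h => absurd h (lt_irrefl _)⟩⟩
    have : shift (n + 1) (fun _ => (0 : ℤ)) = fun _ => 0 := rfl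
    rw [this, val_zero]
    exact zero_lt_one
  have hbig : m < 2 * (q - 1) := by
    obtain ⟨p, hp⟩ := exists_ne_zero_of_val_pos (hv ▸ zero_lt_one : 0 < val q a)
    by_cases hex : ∃ p', a p' ≠ m
    · obtain ⟨p', hp'⟩ := hex
      exact ha.two_mul_gt hq hqm hp hp'
    · push Not at hex
      rw [show a = fun _ => (m : ℤ) from funext hex, val_const hq, div_eq_one_iff_eq (by linarith)]
        at hv
      push_cast at hv
      linarith
  exact mem_twoBases hq hqm hbig hz ha (by rw [val_zero, hv, add_zero])

lemma mem_twoBases_of_mem_vBases (hm : 1 ≤ m) (hV : q ∈ vBases m) (hG : q ≠ goldenRatio m) :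
    q ∈ twoBases m := by
  by_cases hU : q ∈ univoqueBases m
  · exact univoqueBases_subset_twoBases hm hU
  · exact (mem_of_mem_vBases hm hV hG hU).1

lemma isClosed_twoBases (hm : 1 ≤ m) : IsClosed (twoBases m) := by
  refine isClosed_iff_clusterPt.2 fun q hq => ?_
  by_contra hnot
  have hacc : AccPt q (𝓟 (twoBases m)) := by
    rwa [accPt_principal_iff_clusterPt, sdiff_singleton_eq_self hnot]
  obtain ⟨Q, hQ⟩ := exists_isQf hm
  have hle := le_of_accPt hQ hm hacc
  have hqm : q ≤ m + 1 := closure_minimal (fun x hx => hx.1.2) isClosed_Iic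
    (mem_closure_iff_clusterPt.2 hq)
  have hq' : q ∈ Ioc (1 : ℝ) (m + 1) := ⟨hQ.one_lt.trans_le hle, hqm⟩
  by_cases hV : q ∈ vBases m
  · exact hnot (mem_twoBases_of_mem_vBases hm hV (hQ.goldenRatio_lt.trans_le hle).ne')
  · exact hnot (mem_twoBases_of_accPt hq' (by have := hQ.two_mul_gt; linarith) hV hacc)

lemma isCompact_twoBases (hm : 1 ≤ m) : IsCompact (twoBases m) :=
  (isCompact_Icc (a := (1 : ℝ)) (b := m + 1)).of_isClosed_subset (isClosed_twoBases hm)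
    fun _ hx => ⟨hx.1.1.le, hx.1.2⟩

/-- Derived sets are closed. -/
lemma mem_iterTwoBases_succ_of_mem_closure {i : ℕ} (hq : q ∈ Ioc (1 : ℝ) (m + 1))
    (h : q ∈ closure (iterTwoBases m (i + 1))) : q ∈ iterTwoBases m (i + 1) := by
  have h1 : iterTwoBases m (i + 1) ⊆ derivedSet (iterTwoBases m i) := fun x hx => hx.2
  exact ⟨hq, closure_minimal h1 (isClosed_derivedSet _) h⟩

lemma iterTwoBases_two_subset : iterTwoBases m 2 ⊆ iterTwoBases m 1 := fun _ hq =>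
  mem_iterTwoBases_succ_of_mem_closure hq.1 (mem_closure_iff_clusterPt.2 hq.2.clusterPt)

lemma periodicBases_subset_iterTwoBases (i : ℕ) : periodicBases m ⊆ iterTwoBases m i := by
  induction i with
  | zero =>
    rintro q ⟨hq, hqm, a, hbal, hv, hlt, hper⟩
    exact (mem_of_periodic hq hqm hbal hv hlt hper).1
  | succ i ih =>
    intro q hq
    exact ⟨⟨hq.1, hq.2.1.le⟩, (accPt_periodicBases hq).mono (principal_mono.2 ih)⟩

lemma closure_univoqueBases_subset (hm : 1 ≤ m) :
    closure (univoqueBases m) ⊆ infTwoBases m := by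
  intro q hqU
  have hB : q ∈ twoBases m :=
    closure_minimal (univoqueBases_subset_twoBases hm) (isClosed_twoBases hm) hqU
  have hP : q ∈ closure (periodicBases m) :=
    closure_minimal (univoqueBases_subset_closure hm) isClosed_closure hqU
  refine mem_iInter.2 fun i => ?_
  cases i with
  | zero => exact hB
  | succ i =>
    exact mem_iterTwoBases_succ_of_mem_closure hB.1
      (closure_mono (periodicBases_subset_iterTwoBases (i + 1)) hP)

lemma vBases_diff_subset (hm : 1 ≤ m) : vBases m \ {goldenRatio m} ⊆ iterTwoBases m 2 := by
  rintro q ⟨hV, hG⟩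
  by_cases hU : q ∈ univoqueBases m
  · exact mem_iInter.1 (closure_univoqueBases_subset hm (subset_closure hU)) 2
  · exact (mem_of_mem_vBases hm hV hG hU).2

lemma IsQf.isLeast {Q : ℝ} (h : IsQf m Q) (hm : 1 ≤ m) :
    IsLeast (iterTwoBases m 1) Q ∧ IsLeast (iterTwoBases m 2) Q := by
  have h2 : Q ∈ iterTwoBases m 2 := vBases_diff_subset hm ⟨h.mem_vBases, h.goldenRatio_lt.ne'⟩
  have h1 : ∀ q ∈ iterTwoBases m 1, Q ≤ q := fun q hq => le_of_accPt h hm hq.2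
  exact ⟨⟨iterTwoBases_two_subset h2, h1⟩, h2, fun q hq => h1 q (iterTwoBases_two_subset hq)⟩

end TwoExpansions

theorem theorem1p2 (m : ℕ) (hm : 1 ≤ m) :
    IsCompact (TwoExpansions.twoBases m) ∧
    closure (TwoExpansions.univoqueBases m) ⊆ TwoExpansions.infTwoBases m ∧
    TwoExpansions.vBases m \ {TwoExpansions.goldenRatio m} ⊆ TwoExpansions.iterTwoBases m 2 ∧
    (∀ k : ℕ, m = 2 * k + 1 →
      ∃ qf : ℝ,
        IsGreatest {q : ℝ | q ^ 3 - ((k : ℝ) + 2) * q ^ 2 + q - (k : ℝ) - 1 = 0} qf ∧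
        IsLeast (TwoExpansions.iterTwoBases m 1) qf ∧
        IsLeast (TwoExpansions.iterTwoBases m 2) qf) ∧
    (∀ k : ℕ, m = 2 * k →
      ∃ qf : ℝ,
        IsGreatest {q : ℝ | q ^ 2 - ((k : ℝ) + 1) * q - (k : ℝ) = 0} qf ∧
        IsLeast (TwoExpansions.iterTwoBases m 1) qf ∧
        IsLeast (TwoExpansions.iterTwoBases m 2) qf) := by
  refine ⟨TwoExpansions.isCompact_twoBases hm, TwoExpansions.closure_univoqueBases_subset hm,
    TwoExpansions.vBases_diff_subset hm, ?_, ?_⟩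
  · rintro k rfl
    obtain ⟨Q, hQ, hgr⟩ := TwoExpansions.exists_isQf_odd k
    exact ⟨Q, hgr, hQ.isLeast hm⟩
  · rintro k rfl
    obtain ⟨Q, hQ, hgr⟩ := TwoExpansions.exists_isQf_even k (by omega)
    exact ⟨Q, hgr, hQ.isLeast hm⟩
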